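/- Fix an integer $B\ge 0$ and $\lambda\in(0,1)$. Consider $N$ strictly totally ordered candidates arriving in uniformly random order $x_1,\dots,x_N$; independently of the order, each candidate belongs to group $G^1$ with probability $\lambda$ and to group $G^2$ with probability $1-\lambda$, the memberships $g_1,\dots,g_N$ being mutually independent. For $\alpha,\beta\in[0,1]$ the double-threshold algorithm $\mathcal A^B(\alpha,\beta)$, with threshold $\alpha$ for $G^1$ and $\beta$ for $G^2$, starts with budget $b=B$ and proceeds as follows at steps $t=1,\dots,N$. If $t\ge\lfloor\alpha N\rfloor$ (when $g_t=1$), respectively $t\ge\lfloor\beta N\rfloor$ (when $g_t=2$), and $x_t$ is the best candidate of its own group observed so far, then: if $b=0$ it selects $x_t$ and stops; if $b>0$ it decreases $b$ by $1$ and learns whether $x_t$ is the best of all candidates observed so far, and it selects $x_t$ and stops if this is the case, and rejects $x_t$ otherwise. In all other cases $x_t$ is rejected. The algorithm succeeds if it selects the best of all $N$ candidates. For $w\in(0,1]$ put $S^B(w)=\sum_{b=0}^B\Bigl(\frac1w-\sum_{\ell=0}^b\frac{\log(1/w)^\ell}{\ell!}\Bigr)$, and for $\mu\in(0,1)$ and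 $\beta\in(0,1]$ put $$h^B_\mu(\beta)=\min\Bigl\{\frac{\beta}{e}\exp\Bigl(\frac{\beta S^B(\beta)}{\mu}\Bigr),\ \beta\Bigr\},\qquad F^B_\mu(\beta)=\mu\,h^B_\mu(\beta)\log\Bigl(\frac{\beta}{h^B_\mu(\beta)}\Bigr)+h^B_\mu(\beta)\,\beta\,S^B(\beta),$$ and $h^B_\mu(0)=F^B_\mu(0)=0$ (the limits as $\beta\to 0^+$). (1) If $\lambda\ge 1/2$, then $F^B_\lambda$ attains its maximum on $[0,1]$, and for every maximizer $\tilde\beta_B$ of $F^B_\lambda$ on $[0,1]$, with $\tilde\alpha_B=h^B_\lambda(\tilde\beta_B)$, the following limit exists and satisfies $$\lim_{N\to\infty}\Pr\bigl(\mathcal A^B(\tilde\alpha_B,\tilde\beta_B)\text{ succeeds}\bigr)\ \ge\ \frac1e-\min\Bigl\{\frac{1}{e\,(B+1)!},\ \Bigl(\frac4e-1\Bigr)\lambda(1-\lambda)\Bigr\}.$$ (2) If $\lambda<1/2$, the same holds with the roles of the two groups exchanged: $F^B_{1-\lambda}$ attains its maximum on $[0,1]$, and for every maximizer $\tilde\beta_B$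 of $F^B_{1-\lambda}$ on $[0,1]$, with $\tilde\alpha_B=h^B_{1-\lambda}(\tilde\beta_B)$, the limit $\lim_{N\to\infty}\Pr\bigl(\mathcal A^B(\tilde\beta_B,\tilde\alpha_B)\text{ succeeds}\bigr)$ exists and satisfies the same lower bound. -/

import Mathlib

open Filter Topology

noncomputable section

namespace MultiColorSecretary

/-- In-group rank `r_t` of the candidate arriving at time `t` among the candidates observed
so far. Candidates are the elements of `Fin N` (larger is better), `x` is the arrival order
(`x t` arrives at time `t`), and `g t` is the group of the candidate arriving at time `t`.
Times are indexed from `0`: the index `t` stands for step `t + 1`. -/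
def inGroupRank {K N : ℕ} (x : Equiv.Perm (Fin N)) (g : Fin N → Fin K) (t : Fin N) : ℕ :=
  (Finset.univ.filter fun s : Fin N => s ≤ t ∧ x t ≤ x s ∧ g s = g t).card

/-- Overall rank `R_t` of the candidate arriving at time `t` among those observed so far. -/
def overallRank {N : ℕ} (x : Equiv.Perm (Fin N)) (t : Fin N) : ℕ :=
  (Finset.univ.filter fun s : Fin N => s ≤ t ∧ x t ≤ x s).card

/-- Dynamic-threshold algorithm with thresholds `thr k b` (group `k`, available budget `b`),
run through the given list of remaining times with available budget `b`. It returns the time at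
which a candidate is selected (`none` if no candidate is selected). -/
def dtRun {K N : ℕ} (thr : Fin K → ℕ → ℝ) (x : Equiv.Perm (Fin N)) (g : Fin N → Fin K) :
    List (Fin N) → ℕ → Option (Fin N)
  | [], _ => none
  | t :: ts, 0 =>
      if ⌊thr (g t) 0 * N⌋₊ ≤ (t : ℕ) + 1 ∧ inGroupRank x g t = 1 then some t
      else dtRun thr x g ts 0
  | t :: ts, b + 1 =>
      if ⌊thr (g t) (b + 1) * N⌋₊ ≤ (t : ℕ) + 1 ∧ inGroupRank x g t = 1 then
        if overallRank x t = 1 then some t else dtRun thr x g ts b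
      else dtRun thr x g ts (b + 1)

/-- The dynamic-threshold algorithm with initial budget `B` selects the best candidate. -/
def DTSucceeds {K N : ℕ} (thr : Fin K → ℕ → ℝ) (B : ℕ)
    (x : Equiv.Perm (Fin N)) (g : Fin N → Fin K) : Prop :=
  ∃ t : Fin N, dtRun thr x g (List.finRange N) B = some t ∧ ∀ s : Fin N, x s ≤ x t

open Classical in
/-- Success probability when the arrival order is uniform over all `N!` orders and,
independently of it, the groups are i.i.d. with `P(g_t = k) = p k`. -/
def dtSuccessProb {K : ℕ} (p : Fin K → ℝ) (thr : Fin K → ℕ → ℝ) (B N : ℕ) : ℝ :=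
  ∑ x : Equiv.Perm (Fin N), ∑ g : Fin N → Fin K,
    (1 / (N.factorial : ℝ)) * (∏ t : Fin N, p (g t)) * (if DTSucceeds thr B x g then 1 else 0)

/-- Success probability, with `N` candidates, of the double-threshold algorithm `A^B(a, b)` for
two groups of proportions `lam` and `1 - lam`, with threshold `⌊a N⌋` for the first group and
`⌊b N⌋` for the second group, whatever the available budget. -/
def doubleThresholdSuccessProb (lam : ℝ) (B : ℕ) (a b : ℝ) (N : ℕ) : ℝ :=
  dtSuccessProb ![lam, 1 - lam] (fun k _ => ![a, b] k) B N

/-- `S^B(w) = ∑_{b=0}^{B} (1/w - ∑_{l=0}^{b} log(1/w)^l / l!)`, for `w ∈ (0, 1]`. -/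
def S (B : ℕ) (w : ℝ) : ℝ :=
  ∑ b ∈ Finset.range (B + 1),
    (1 / w - ∑ l ∈ Finset.range (b + 1), Real.log (1 / w) ^ l / (l.factorial : ℝ))

/-- `h^B(β) = min {(β/e) exp(β S^B(β) / lam), β}`. -/
def h (lam : ℝ) (B : ℕ) (β : ℝ) : ℝ :=
  min (β / Real.exp 1 * Real.exp (β * S B β / lam)) β

/-- `β ↦ lam h^B(β) log(β / h^B(β)) + h^B(β) β S^B(β)`. At `β = 0` it takes the value `0`,
which is also its limit there. -/
def objective (lam : ℝ) (B : ℕ) (β : ℝ) : ℝ :=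
  lam * h lam B β * Real.log (β / h lam B β) + h lam B β * β * S B β

theorem objective_zero (lam : ℝ) (B : ℕ) : objective lam B 0 = 0 := by
  simp [objective, h]

/-- `β` maximizes the objective on `[0, 1]`. -/
def IsOptimalThreshold (lam : ℝ) (B : ℕ) (β : ℝ) : Prop :=
  β ∈ Set.Icc (0 : ℝ) 1 ∧ IsMaxOn (objective lam B) (Set.Icc (0 : ℝ) 1) β

/-- The guarantee `1/e - min {1 / (e (B+1)!), (4/e - 1) lam (1 - lam)}`. -/
def guarantee (lam : ℝ) (B : ℕ) : ℝ :=
  1 / Real.exp 1 - min (1 / (Real.exp 1 * ((B + 1).factorial : ℝ)))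
    ((4 / Real.exp 1 - 1) * lam * (1 - lam))

end MultiColorSecretary

end

namespace MultiColorSecretary

/-! List the candidates from best to worst, each with its arrival time and group. For fixed `m` and
`N → ∞`, the first `m` times divided by `N` become independent and uniform on `(0, 1)`, independent
of the groups. Success can be read off this list (`dtSucceeds_iff_succ`): the best candidate arrives
at an allowed time `s`, at most `B` earlier candidates are group records past their threshold, and
each of these is preceded in time by a better candidate. Once each group has shown a candidate
arriving before its threshold, the rest of the list is irrelevant (`succ_append`). A prefix of
length `m` thus decides, up to an error geometrically small in `m`, and the limit exists by
`exists_tendsto_of_sandwich`.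

The limit is bounded below by keeping favourable scenarios only (`le_contProb_succ`). Let `α ≤ β` be
the thresholds, `λ` the proportion of the group with threshold `α`, and `s` the arrival time of the
best candidate. For `α < s < β` this candidate has to be of that group, and the best member of the
group before `s` is required to arrive before `α`: probability `α / s`. For `s > β` the best
candidate before `s` must precede the threshold of its group; in the other group, no record is
admitted between the threshold and `β`, and at most `B` between `β` and `s`, where the number of
records is Poisson of mean `log (s / β)`. This gives `α β / s² · ∑_{l ≤ B} log (s / β)^l / l!`.
Integration over `s` produces `λ α log (β / α) + α β S^B(β)`.

For fixed `β` this is largest at `α = h^B(β)` (`le_objective`), so a maximizer of the objective does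
at least as well as `α = β = 1/e` and as `β = λ`, `α = λ exp ((1 - λ) / λ - 1)`. These two pairs
yield the two terms of the minimum (`guarantee_le_of_isOptimalThreshold`). -/

/-! ### Bounds on `S` and the optimal smaller threshold -/

theorem sum_log_pow_le {w : ℝ} (hw0 : 0 < w) (hw1 : w ≤ 1) (n : ℕ) :
    ∑ l ∈ Finset.range n, Real.log (1 / w) ^ l / (l.factorial : ℝ) ≤ 1 / w := by
  have h1 : 0 ≤ Real.log (1 / w) := Real.log_nonneg (by rw [le_div_iff₀ hw0]; linarith)
  refine (Real.sum_le_exp_of_nonneg h1 n).trans ?_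
  rw [Real.exp_log (by positivity)]

theorem S_nonneg {w : ℝ} (hw0 : 0 < w) (hw1 : w ≤ 1) (B : ℕ) : 0 ≤ S B w :=
  Finset.sum_nonneg fun b _ => sub_nonneg.2 (sum_log_pow_le hw0 hw1 (b + 1))

theorem one_div_sub_one_le_S {w : ℝ} (hw0 : 0 < w) (hw1 : w ≤ 1) (B : ℕ) :
    1 / w - 1 ≤ S B w := by
  have := Finset.single_le_sum
    (f := fun b => 1 / w - ∑ l ∈ Finset.range (b + 1), Real.log (1 / w) ^ l / (l.factorial : ℝ))
    (s := Finset.range (B + 1))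
    (fun b _ => sub_nonneg.2 (sum_log_pow_le hw0 hw1 (b + 1))) (Finset.mem_range.2 B.succ_pos)
  simpa [S] using this

theorem mul_S_le {w : ℝ} (hw0 : 0 < w) (hw1 : w ≤ 1) (B : ℕ) : w * S B w ≤ B + 1 := by
  have h1 : 0 ≤ Real.log (1 / w) := Real.log_nonneg (by rw [le_div_iff₀ hw0]; linarith)
  have : S B w ≤ ∑ b ∈ Finset.range (B + 1), 1 / w := by
    refine Finset.sum_le_sum fun b _ => sub_le_self _ (Finset.sum_nonneg fun l _ => by positivity)
  calc w * S B w ≤ w * ∑ b ∈ Finset.range (B + 1), 1 / w := by gcongr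
    _ = B + 1 := by simp; field_simp

theorem h_pos {lam β : ℝ} (B : ℕ) (hβ : 0 < β) : 0 < h lam B β :=
  lt_min (by positivity) hβ

theorem h_le (lam β : ℝ) (B : ℕ) : h lam B β ≤ β := min_le_right _ _

/-- The function `y ↦ y (c - log y)` increases up to `exp (c - 1)` and decreases afterwards, so the
constraint `y ≤ 1` moves the maximizer to `min (exp (c - 1)) 1`. With `α = β y` and `c = β S / lam`
this is the choice of `α` made by `h`. -/
theorem mul_exponent_sub_log_le {c y : ℝ} (hy : 0 < y) (hy1 : y ≤ 1) :
    y * (c - Real.log y) ≤ min (Real.exp (c - 1)) 1 * (c - Real.log (min (Real.exp (c - 1)) 1)) := by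
  rcases le_total c 1 with hc | hc
  · rw [min_eq_left (by rw [Real.exp_le_one_iff]; linarith), Real.log_exp]
    have h1 := Real.add_one_le_exp (c - 1 - Real.log y)
    have h2 : Real.exp (c - 1 - Real.log y) = Real.exp (c - 1) / y := by
      rw [Real.exp_sub, Real.exp_log hy]
    rw [h2, le_div_iff₀ hy] at h1
    nlinarith
  · rw [min_eq_right (by rw [Real.one_le_exp_iff]; linarith), Real.log_one]
    have h1 := Real.log_le_sub_one_of_pos (inv_pos.2 hy)
    rw [Real.log_inv] at h1
    have h2 : y * (-Real.log y) ≤ 1 - y := by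
      have := mul_le_mul_of_nonneg_left h1 hy.le
      rwa [mul_sub, mul_inv_cancel₀ hy.ne', mul_one] at this
    nlinarith

theorem le_objective {lam α β : ℝ} (B : ℕ) (hlam : 0 < lam) (hα : 0 < α) (hαβ : α ≤ β) :
    lam * α * Real.log (β / α) + α * β * S B β ≤ objective lam B β := by
  have hβ : 0 < β := hα.trans_le hαβ
  have key : ∀ y : ℝ, 0 < y → lam * (β * y) * Real.log (β / (β * y)) + β * y * β * S B β
      = lam * β * (y * (β * S B β / lam - Real.log y)) := by
    intro y hy
    rw [div_mul_cancel_left₀ hβ.ne', Real.log_inv]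
    field_simp
    ring
  have hh : h lam B β = β * min (Real.exp (β * S B β / lam - 1)) 1 := by
    rw [mul_min_of_nonneg _ _ hβ.le, h, Real.exp_sub, mul_one]
    congr 1
    ring
  have h1 := key (α / β) (by positivity)
  rw [mul_div_cancel₀ _ hβ.ne'] at h1
  rw [h1, objective, hh, key _ (by positivity)]
  have := mul_exponent_sub_log_le (c := β * S B β / lam) (y := α / β) (by positivity)
    (by rw [div_le_one hβ]; exact hαβ)
  gcongr

/-! ### The guarantee from two explicit pairs of thresholds -/

theorem S_exp_neg_one (B : ℕ) :
    S B (Real.exp (-1)) = Real.exp 1 - 1 / (B.factorial : ℝ)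
      + B * (Real.exp 1 - ∑ l ∈ Finset.range (B + 1), 1 / (l.factorial : ℝ)) := by
  have h1 : 1 / Real.exp (-1) = Real.exp 1 := by rw [Real.exp_neg]; simp
  simp only [S, h1, Real.log_exp, one_pow]
  induction B with
  | zero => simp
  | succ B ih =>
    rw [Finset.sum_range_succ, ih, Finset.sum_range_succ _ (B + 1), Nat.factorial_succ]
    push_cast
    field_simp
    ring

/-- Keeping only the term `1 / (B+1)!` of the tail of the series of `e` already gives `e - 1 /
(B+1)!`. The weaker form is the one that becomes `1/e - 1 / (e (B+1)!)` after multiplication by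
`e⁻²`. -/
theorem S_exp_neg_one_ge (B : ℕ) :
    Real.exp 1 - Real.exp 1 / ((B + 1).factorial : ℝ) ≤ S B (Real.exp (-1)) := by
  rw [S_exp_neg_one]
  have h1 := Real.sum_le_exp_of_nonneg zero_le_one (B + 2)
  rw [Finset.sum_range_succ] at h1
  simp only [one_pow] at h1
  have h2 : (1 : ℝ) / ((B + 1).factorial : ℝ) ≤ Real.exp 1 -
    ∑ l ∈ Finset.range (B + 1), 1 / (l.factorial : ℝ) := by linarith
  have h3 : (B : ℝ) * (1 / ((B + 1).factorial : ℝ)) ≤ B * (Real.exp 1 -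
    ∑ l ∈ Finset.range (B + 1), 1 / (l.factorial : ℝ)) := by gcongr
  have h4 : (1 : ℝ) / (B.factorial : ℝ) = (B + 1) * (1 / ((B + 1).factorial : ℝ)) := by
    rw [Nat.factorial_succ]; push_cast; field_simp
  have h5 : 1 / ((B + 1).factorial : ℝ) ≤ Real.exp 1 / ((B + 1).factorial : ℝ) := by
    gcongr
    linarith [Real.add_one_le_exp 1]
  linarith

/-- The difference `f` vanishes at `0` and `1`, `f' 1 = 0`, and `f''` changes sign only at `log 2`.
On `[log 2, 1]` it is convex with zero slope at the right end, hence decreasing to `0`; on `[0, log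
2]` it is concave and nonnegative at both ends. -/
theorem one_add_sq_add_mul_le_exp {s : ℝ} (h0 : 0 ≤ s) (h1 : s ≤ 1) :
    1 + s ^ 2 + (Real.exp 1 - 2) * s ≤ Real.exp s := by
  set f : ℝ → ℝ := fun s => Real.exp s - (1 + s ^ 2 + (Real.exp 1 - 2) * s) with hf
  set f' : ℝ → ℝ := fun s => Real.exp s - (2 * s + (Real.exp 1 - 2)) with hf'
  have hd : ∀ x, HasDerivAt f (f' x) x := by
    intro x
    have := (Real.hasDerivAt_exp x).sub (((hasDerivAt_pow 2 x).const_add 1).add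
      ((hasDerivAt_id x).const_mul (Real.exp 1 - 2)))
    exact this.congr_deriv (by simp [hf'])
  have hd' : ∀ x, HasDerivAt f' (Real.exp x - 2) x := by
    intro x
    have := (Real.hasDerivAt_exp x).sub (((hasDerivAt_id x).const_mul 2).add_const (Real.exp 1 - 2))
    exact this.congr_deriv (by simp)
  have hf0 : f 0 = 0 := by simp [hf]
  have hf1 : f 1 = 0 := by simp [hf]; ring
  have hf'1 : f' 1 = 0 := by simp [hf']
  have hl0 : 0 ≤ Real.log 2 := Real.log_nonneg (by norm_num)
  have hl1 : Real.log 2 ≤ 1 := by linarith [Real.log_two_lt_d9]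
  have hright : ∀ x ∈ Set.Icc (Real.log 2) 1, 0 ≤ f x := by
    have hmono : MonotoneOn f' (Set.Ici (Real.log 2)) := by
      refine monotoneOn_of_hasDerivWithinAt_nonneg (convex_Ici _)
        (fun x _ => (hd' x).continuousAt.continuousWithinAt)
        (fun x _ => (hd' x).hasDerivWithinAt) ?_
      intro x hx
      rw [interior_Ici] at hx
      have := Real.exp_le_exp.2 (le_of_lt hx)
      rw [Real.exp_log (by norm_num)] at this
      linarith
    have hanti : AntitoneOn f (Set.Icc (Real.log 2) 1) := by
      refine antitoneOn_of_hasDerivWithinAt_nonpos (convex_Icc _ _)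
        (fun x _ => (hd x).continuousAt.continuousWithinAt)
        (fun x _ => (hd x).hasDerivWithinAt) ?_
      intro x hx
      rw [interior_Icc] at hx
      rw [← hf'1]
      exact hmono hx.1.le hl1 hx.2.le
    intro x hx
    rw [← hf1]
    exact hanti hx ⟨hl1, le_rfl⟩ hx.2
  rcases le_total (Real.log 2) s with hs | hs
  · have := hright s ⟨hs, h1⟩
    simp only [hf] at this
    linarith
  · have hconc : ConcaveOn ℝ (Set.Icc 0 (Real.log 2)) f := by
      refine AntitoneOn.concaveOn_of_deriv (convex_Icc _ _)
        (fun x _ => (hd x).continuousAt.continuousWithinAt)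
        (fun x _ => (hd x).differentiableAt.differentiableWithinAt) ?_
      have hde : deriv f = f' := funext fun x => (hd x).deriv
      rw [hde, interior_Icc]
      refine antitoneOn_of_hasDerivWithinAt_nonpos (f' := fun x => Real.exp x - 2)
        (convex_Ioo _ _) (fun x _ => (hd' x).continuousAt.continuousWithinAt)
        (fun x _ => (hd' x).hasDerivWithinAt) ?_
      intro x hx
      rw [interior_Ioo] at hx
      have := Real.exp_le_exp.2 (le_of_lt hx.2)
      rw [Real.exp_log (by norm_num)] at this
      linarith
    have := hconc.min_le_of_mem_Icc (x := 0) (y := Real.log 2) (z := s)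
      ⟨le_rfl, hl0⟩ ⟨hl0, le_rfl⟩ ⟨h0, hs⟩
    have h2 : 0 ≤ f s := le_trans (le_min hf0.ge (hright _ ⟨le_rfl, hl1⟩)) this
    simp only [hf] at h2
    linarith

/-- For `s = (1 - lam) / lam`, which is at most `1` because `lam ≥ 1/2`, multiplying `1 + s² + (e -
2) s` by `lam²` gives exactly `1 - (4 - e) lam (1 - lam)`. -/
theorem guarantee_le_mul_sq {lam : ℝ} (h0 : 1 / 2 ≤ lam) (h1 : lam ≤ 1) :
    1 / Real.exp 1 - (4 / Real.exp 1 - 1) * lam * (1 - lam)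
      ≤ lam ^ 2 * Real.exp ((1 - lam) / lam - 1) := by
  have hlam : 0 < lam := by linarith
  have h2 := one_add_sq_add_mul_le_exp (s := (1 - lam) / lam)
    (div_nonneg (by linarith) hlam.le) (by rw [div_le_one hlam]; linarith)
  rw [Real.exp_sub]
  have he := Real.exp_pos 1
  have h3 : lam ^ 2 * (1 + ((1 - lam) / lam) ^ 2 + (Real.exp 1 - 2) * ((1 - lam) / lam))
      ≤ lam ^ 2 * Real.exp ((1 - lam) / lam) := by gcongr
  have h4 : lam ^ 2 * (1 + ((1 - lam) / lam) ^ 2 + (Real.exp 1 - 2) * ((1 - lam) / lam))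
      = 1 - (4 - Real.exp 1) * lam * (1 - lam) := by
    field_simp
    ring
  rw [h4] at h3
  rw [mul_div_assoc', le_div_iff₀ he]
  refine le_trans (le_of_eq ?_) h3
  field_simp

theorem guarantee_le_of_isOptimalThreshold {lam β : ℝ} {B : ℕ} (h0 : 1 / 2 ≤ lam) (h1 : lam ≤ 1)
    (hβ : IsOptimalThreshold lam B β) : guarantee lam B ≤ objective lam B β := by
  have hlam : 0 < lam := by linarith
  have hmax : ∀ w ∈ Set.Icc (0 : ℝ) 1, objective lam B w ≤ objective lam B β := fun w hw => hβ.2 hw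
  rw [guarantee, sub_le_comm]
  refine le_min ?_ ?_ <;> rw [sub_le_comm]
  · have he := Real.exp_pos (-1)
    have he1 : Real.exp (-1) ≤ 1 := by rw [Real.exp_le_one_iff]; norm_num
    -- Thresholds `α = β = 1/e`: the logarithm vanishes and `e⁻² S(1/e)` remains.
    refine le_trans ?_ ((le_objective B hlam he le_rfl).trans (hmax _ ⟨he.le, he1⟩))
    rw [div_self he.ne', Real.log_one, mul_zero, zero_add]
    have := mul_le_mul_of_nonneg_left (S_exp_neg_one_ge B) (mul_pos he he).le
    refine le_trans (le_of_eq ?_) this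
    rw [Real.exp_neg]
    field_simp
  · refine (guarantee_le_mul_sq h0 h1).trans ?_
    set c := (1 - lam) / lam with hc
    have hc1 : c ≤ 1 := by rw [hc, div_le_one hlam]; linarith
    have hexp : Real.exp (c - 1) ≤ 1 := by rw [Real.exp_le_one_iff]; linarith
    have hα : 0 < lam * Real.exp (c - 1) := by positivity
    -- Threshold `β = lam`, with the `α` that `h` gives there for `B = 0`. As `S(lam) ≥ 1 / lam - 1
    -- = c`, the value is at least `lam² exp (c - 1)`.
    refine le_trans ?_ ((le_objective B hlam hα (mul_le_of_le_one_right hlam.le hexp)).trans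
      (hmax _ ⟨hlam.le, h1⟩))
    rw [div_mul_cancel_left₀ hlam.ne', Real.log_inv, Real.log_exp]
    have := mul_le_mul_of_nonneg_left (one_div_sub_one_le_S hlam h1 B) (mul_pos hα hlam).le
    refine le_trans (le_of_eq ?_) (add_le_add_right this _)
    rw [hc]
    field_simp
    ring

/-! ### Continuity of the objective and existence of a maximizer -/

theorem continuousOn_S (B : ℕ) : ContinuousOn (S B) (Set.Ioi 0) := by
  unfold S
  have h1 : ContinuousOn (fun w : ℝ => 1 / w) (Set.Ioi 0) :=
    continuousOn_const.div continuousOn_id fun w hw => (ne_of_gt hw)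
  have h2 : ContinuousOn (fun w : ℝ => Real.log (1 / w)) (Set.Ioi 0) :=
    h1.log fun w hw => (one_div_pos.2 hw).ne'
  refine continuousOn_finsetSum _ fun b _ => h1.sub ?_
  exact continuousOn_finsetSum _ fun l _ => (h2.pow l).div_const _

theorem continuousOn_objective_Ioi (lam : ℝ) (B : ℕ) :
    ContinuousOn (objective lam B) (Set.Ioi 0) := by
  have hS := continuousOn_S B
  have hh : ContinuousOn (h lam B) (Set.Ioi 0) := by
    unfold h
    exact ((continuousOn_id.div_const _).mul
      (((continuousOn_id.mul hS).div_const _).rexp)).inf continuousOn_id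
  unfold objective
  refine ((continuousOn_const.mul hh).mul (ContinuousOn.log (continuousOn_id.div hh ?_) ?_)).add
    ((hh.mul continuousOn_id).mul hS)
  · exact fun w hw => (h_pos B hw).ne'
  · exact fun w hw => (div_pos hw (h_pos B hw)).ne'

theorem objective_nonneg {lam w : ℝ} (B : ℕ) (hlam : 0 < lam) (hw0 : 0 < w) (hw1 : w ≤ 1) :
    0 ≤ objective lam B w := by
  have hh := h_pos (lam := lam) B hw0
  have h1 : 0 ≤ Real.log (w / h lam B w) :=
    Real.log_nonneg (by rw [le_div_iff₀ hh, one_mul]; exact h_le _ _ _)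
  have := S_nonneg hw0 hw1 B
  unfold objective
  positivity

/-- Since `h` lies between `w / e` and `w`, the logarithm is at most `1`. The resulting linear bound
gives continuity at `0`, where `S` blows up. -/
theorem objective_le {lam w : ℝ} (B : ℕ) (hlam : 0 < lam) (hw0 : 0 < w) (hw1 : w ≤ 1) :
    objective lam B w ≤ w * (lam + (B + 1)) := by
  have hh := h_pos (lam := lam) B hw0
  have hS := S_nonneg hw0 hw1 B
  have h1 : w / Real.exp 1 ≤ h lam B w := by
    refine le_min ?_ (div_le_self hw0.le (by linarith [Real.add_one_le_exp 1]))
    refine le_mul_of_one_le_right (by positivity) (Real.one_le_exp (by positivity))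
  have h2 : Real.log (w / h lam B w) ≤ 1 := by
    rw [Real.log_le_iff_le_exp (by positivity), div_le_iff₀ hh]
    rwa [div_le_iff₀' (Real.exp_pos 1)] at h1
  have h3 := mul_S_le hw0 hw1 B
  have h4 : 0 ≤ w * S B w := by positivity
  calc objective lam B w = lam * h lam B w * Real.log (w / h lam B w) + h lam B w * (w * S B w) := by
        rw [objective]; ring
    _ ≤ lam * h lam B w * 1 + h lam B w * (B + 1) := by gcongr
    _ = h lam B w * (lam + (B + 1)) := by ring
    _ ≤ w * (lam + (B + 1)) := by gcongr; exact h_le _ _ _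

theorem continuousOn_objective {lam : ℝ} (B : ℕ) (hlam : 0 < lam) :
    ContinuousOn (objective lam B) (Set.Icc 0 1) := by
  intro w hw
  rcases hw.1.eq_or_lt with h0 | h0
  · subst h0
    rw [ContinuousWithinAt, objective_zero]
    have hlim : Tendsto (fun w : ℝ => w * (lam + (B + 1))) (𝓝[Set.Icc 0 1] 0) (𝓝 0) := by
      have : Continuous fun w : ℝ => w * (lam + (B + 1)) := by fun_prop
      simpa using (this.tendsto 0).mono_left nhdsWithin_le_nhds
    refine tendsto_of_tendsto_of_tendsto_of_le_of_le' tendsto_const_nhds hlim ?_ ?_ <;>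
      filter_upwards [self_mem_nhdsWithin] with w hw <;>
      rcases hw.1.eq_or_lt with h0 | h0
    · rw [← h0, objective_zero]
    · exact objective_nonneg B hlam h0 hw.2
    · rw [← h0, objective_zero, zero_mul]
    · exact objective_le B hlam h0 hw.2
  · exact ((continuousOn_objective_Ioi lam B).continuousAt (Ioi_mem_nhds h0)).continuousWithinAt

theorem exists_isOptimalThreshold {lam : ℝ} (B : ℕ) (hlam : 0 < lam) :
    ∃ β, IsOptimalThreshold lam B β :=
  isCompact_Icc.exists_isMaxOn ⟨0, by simp⟩ (continuousOn_objective B hlam)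

theorem IsOptimalThreshold.pos {lam β : ℝ} {B : ℕ} (hlam : 0 < lam)
    (hβ : IsOptimalThreshold lam B β) : 0 < β := by
  refine hβ.1.1.lt_of_ne ?_
  rintro rfl
  have h1 : objective lam B (1 / 2) ≤ objective lam B 0 := hβ.2 (by norm_num)
  rw [objective_zero] at h1
  have h2 := le_objective (α := 1 / 2) (β := 1 / 2) B hlam (by norm_num) le_rfl
  rw [div_self (by norm_num), Real.log_one] at h2
  have h3 := one_div_sub_one_le_S (w := 1 / 2) (by norm_num) (by norm_num) B
  norm_num at h3 h2
  linarith

theorem guarantee_one_sub (lam : ℝ) (B : ℕ) : guarantee (1 - lam) B = guarantee lam B := by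
  unfold guarantee
  congr 2
  ring

/-! ### Success read along the candidates sorted from best to worst -/

/-- Scan a list of `(arrival time, group)`, sorted from better to worse candidates, where `F k` is the
earliest arrival time met so far in group `k`. The predicate says that the scanned candidates at which
the algorithm stops to look before time `max F` are at most `c`, and none of them is the best so far. -/
def Run {T : Type*} [LinearOrder T] {K : ℕ} (ok : T → Fin K → Prop) :
    List (T × Fin K) → (Fin K → T) → ℕ → Prop
  | [], _, _ => True
  | (t, k) :: l, F, c =>
      (ok t k ∧ t < F k → (∃ k', F k' < t) ∧ 0 < c ∧
        Run ok l (Function.update F k (min (F k) t)) (c - 1)) ∧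
      (¬ (ok t k ∧ t < F k) → Run ok l (Function.update F k (min (F k) t)) c)

/-- The algorithm succeeds on the candidates with the listed `(arrival time, group)`, sorted from the
best candidate to the worst. -/
def Succ {T : Type*} [LinearOrder T] {K : ℕ} (ok : T → Fin K → Prop) (B : ℕ) :
    List (T × Fin K) → Prop
  | [] => False
  | (s, k) :: l => ok s k ∧ Run ok l (fun _ => s) B

section Run

variable {T : Type*} [LinearOrder T] {K : ℕ} {ok : T → Fin K → Prop}

theorem run_of_not_ok {l : List (T × Fin K)} {F : Fin K → T} {c : ℕ}
    (hF : ∀ k t, t < F k → ¬ ok t k) : Run ok l F c := by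
  induction l generalizing F with
  | nil => trivial
  | cons a l ih =>
    obtain ⟨t, k⟩ := a
    refine ⟨fun h1 => absurd h1.1 (hF k t h1.2), fun _ => ih fun k' t' ht' => ?_⟩
    rcases eq_or_ne k' k with rfl | hk
    · rw [Function.update_self] at ht'
      exact hF _ _ (ht'.trans_le (min_le_left _ _))
    · rw [Function.update_of_ne hk] at ht'
      exact hF _ _ ht'

/-- The running minima only decrease, so once no time below the minimum of any group is allowed, no
further entry can be eligible. -/
theorem run_append {l₁ l₂ : List (T × Fin K)} {F : Fin K → T} {c : ℕ}
    (hl : ∀ k, (∀ t, t < F k → ¬ ok t k) ∨ ∃ x ∈ l₁, x.2 = k ∧ ∀ t, t < x.1 → ¬ ok t k) :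
    Run ok (l₁ ++ l₂) F c ↔ Run ok l₁ F c := by
  induction l₁ generalizing F c with
  | nil =>
    simp only [List.not_mem_nil, false_and, exists_false, or_false] at hl
    exact iff_of_true (run_of_not_ok hl) trivial
  | cons a l ih =>
    obtain ⟨t, k⟩ := a
    have key : ∀ c, Run ok (l ++ l₂) (Function.update F k (min (F k) t)) c ↔
        Run ok l (Function.update F k (min (F k) t)) c := by
      intro c
      refine ih fun k' => ?_
      rcases eq_or_ne k' k with rfl | hk
      · rw [Function.update_self]
        rcases hl k' with h1 | ⟨x, hx, hxk, h1⟩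
        · exact Or.inl fun t' ht' => h1 _ (ht'.trans_le (min_le_left _ _))
        · rcases List.mem_cons.1 hx with h2 | hx
          · subst h2
            exact Or.inl fun t' ht' => h1 _ (ht'.trans_le (min_le_right _ _))
          · exact Or.inr ⟨x, hx, hxk, h1⟩
      · rw [Function.update_of_ne hk]
        rcases hl k' with h1 | ⟨x, hx, rfl, h1⟩
        · exact Or.inl h1
        · rcases List.mem_cons.1 hx with h2 | hx
          · exact absurd (congrArg Prod.snd h2) hk
          · exact Or.inr ⟨x, hx, rfl, h1⟩
    simp only [List.cons_append, Run, key]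

/-- The condition is on `t ≤ x.1`, not `t < x.1`, so that the head of the list, whose time is
allowed, cannot be the witness: `run_append` only sees the tail. -/
theorem succ_append {l₁ l₂ : List (T × Fin K)} {B : ℕ} (hl₁ : l₁ ≠ [])
    (hl : ∀ k, ∃ x ∈ l₁, x.2 = k ∧ ∀ t ≤ x.1, ¬ ok t k) :
    Succ ok B (l₁ ++ l₂) ↔ Succ ok B l₁ := by
  cases l₁ with
  | nil => exact absurd rfl hl₁
  | cons a l =>
    obtain ⟨s, k⟩ := a
    refine and_congr_right fun hs => run_append fun k' => Or.inr ?_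
    obtain ⟨x, hx, rfl, h1⟩ := hl k'
    rcases List.mem_cons.1 hx with h2 | hx
    · subst h2
      exact absurd hs (h1 _ le_rfl)
    · exact ⟨x, hx, rfl, fun t ht => h1 t ht.le⟩

/-- The scan only compares times and tests `ok`, so it is invariant under order-preserving changes
of time. This links integer times to times in `(0, 1)`. -/
theorem run_map {T' : Type*} [LinearOrder T'] {ok' : T' → Fin K → Prop} {φ : T → T'} {A : Set T}
    (hφ : StrictMonoOn φ A) (hok : ∀ t ∈ A, ∀ k, ok' (φ t) k ↔ ok t k)
    {l : List (T × Fin K)} {F : Fin K → T} {c : ℕ} (hl : ∀ x ∈ l, x.1 ∈ A) (hF : ∀ k, F k ∈ A) :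
    Run ok' (l.map fun x => (φ x.1, x.2)) (fun k => φ (F k)) c ↔ Run ok l F c := by
  induction l generalizing F c with
  | nil => exact Iff.rfl
  | cons a l ih =>
    obtain ⟨t, k⟩ := a
    have ht : t ∈ A := hl _ List.mem_cons_self
    have hF' : ∀ k', Function.update F k (min (F k) t) k' ∈ A := by
      intro k'
      rcases eq_or_ne k' k with rfl | hk
      · rw [Function.update_self]
        rcases min_choice (F k') t with h1 | h1 <;> rw [h1]
        exacts [hF _, ht]
      · rw [Function.update_of_ne hk]
        exact hF _
    have hup : (Function.update (fun k => φ (F k)) k (min (φ (F k)) (φ t))) =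
        fun k' => φ (Function.update F k (min (F k) t) k') := by
      funext k'
      rcases eq_or_ne k' k with rfl | hk
      · simp only [Function.update_self]
        exact (hφ.monotoneOn.map_min (hF _) ht).symm
      · simp only [Function.update_of_ne hk]
    have key := fun c => ih (c := c) (fun x hx => hl x (List.mem_cons_of_mem _ hx)) hF'
    simp only [List.map_cons, Run, hup, key, hok t ht, hφ.lt_iff_lt ht (hF _), hφ.lt_iff_lt (hF _) ht]

theorem succ_map {T' : Type*} [LinearOrder T'] {ok' : T' → Fin K → Prop} {φ : T → T'} {A : Set T}
    (hφ : StrictMonoOn φ A) (hok : ∀ t ∈ A, ∀ k, ok' (φ t) k ↔ ok t k)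
    {l : List (T × Fin K)} {B : ℕ} (hl : ∀ x ∈ l, x.1 ∈ A) :
    Succ ok' B (l.map fun x => (φ x.1, x.2)) ↔ Succ ok B l := by
  cases l with
  | nil => exact Iff.rfl
  | cons a l =>
    have ha := hl _ List.mem_cons_self
    exact and_congr (hok _ ha _)
      (run_map hφ hok (fun x hx => hl x (List.mem_cons_of_mem _ hx)) fun _ => ha)

/-- Entry `i` is eligible: its time is accepted by `ok`, and is smaller than `F` and than all previous
times of the same group. -/
def Elig (ok : T → Fin K → Prop) (F : Fin K → T) {n : ℕ} (w : Fin n → T × Fin K) (i : Fin n) : Prop :=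
  ok (w i).1 (w i).2 ∧ (w i).1 < F (w i).2 ∧ ∀ j < i, (w j).2 = (w i).2 → (w i).1 < (w j).1

theorem elig_succ_iff {F : Fin K → T} {n : ℕ} {w : Fin (n + 1) → T × Fin K} {i : Fin n} :
    Elig ok F w i.succ ↔ Elig ok (Function.update F (w 0).2 (min (F (w 0).2) (w 0).1))
      (fun j => w j.succ) i := by
  unfold Elig
  refine and_congr_right fun _ => ?_
  simp only [Fin.forall_fin_succ, Fin.succ_lt_succ_iff, Fin.succ_pos, true_imp_iff]
  rcases eq_or_ne (w i.succ).2 (w 0).2 with h1 | h1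
  · rw [h1, Function.update_self, lt_min_iff, and_assoc]
    simp
  · rw [Function.update_of_ne h1]
    simp [h1.symm]

-- Unrolling the recursion turns the budget into a cardinality and the running minima into arrivals
-- among the previous entries. This form no longer depends on the scanning order of the budget, so
-- it can be matched with the algorithm, which reads candidates by time.
open Classical in
theorem run_ofFn {n : ℕ} {w : Fin n → T × Fin K} {F : Fin K → T} {c : ℕ} :
    Run ok (List.ofFn w) F c ↔ (Finset.univ.filter fun i => Elig ok F w i).card ≤ c ∧
      ∀ i, Elig ok F w i → (∃ k, F k < (w i).1) ∨ ∃ j < i, (w j).1 < (w i).1 := by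
  induction n generalizing F c with
  | zero => simp [Run]
  | succ n ih =>
    have h0 : Elig ok F w 0 ↔ ok (w 0).1 (w 0).2 ∧ (w 0).1 < F (w 0).2 := by simp [Elig]
    set F' := Function.update F (w 0).2 (min (F (w 0).2) (w 0).1) with hF'
    have h1 : ∀ i : Fin n, ((∃ k, F' k < (w i.succ).1) ∨ ∃ j < i, (w j.succ).1 < (w i.succ).1) ↔
        ((∃ k, F k < (w i.succ).1) ∨ ∃ j < i.succ, (w j).1 < (w i.succ).1) := by
      intro i
      have h2 : (∃ k, F' k < (w i.succ).1) ↔ (∃ k, F k < (w i.succ).1) ∨ (w 0).1 < (w i.succ).1 := by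
        constructor
        · rintro ⟨k, hk⟩
          rcases eq_or_ne k (w 0).2 with rfl | hne
          · rw [hF', Function.update_self, min_lt_iff] at hk
            exact hk.imp (fun h => ⟨_, h⟩) id
          · rw [hF', Function.update_of_ne hne] at hk
            exact Or.inl ⟨k, hk⟩
        · rintro (⟨k, hk⟩ | hk)
          · refine ⟨k, ?_⟩
            rcases eq_or_ne k (w 0).2 with rfl | hne
            · rw [hF', Function.update_self]
              exact min_lt_of_left_lt hk
            · rwa [hF', Function.update_of_ne hne]
          · refine ⟨(w 0).2, ?_⟩
            rw [hF', Function.update_self]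
            exact min_lt_of_right_lt hk
      rw [h2, or_assoc]
      refine or_congr_right ?_
      rw [Fin.exists_fin_succ]
      simp [Fin.succ_lt_succ_iff, Fin.succ_pos]
    have h2 : (∃ j < (0 : Fin (n + 1)), (w j).1 < (w 0).1) ↔ False := by simp
    rw [List.ofFn_succ, Run, ← h0, Fin.card_filter_univ_succ, Fin.forall_fin_succ, h2, or_false]
    simp only [← hF', ih, elig_succ_iff, h1]
    by_cases he : Elig ok F w 0
    · simp only [he, true_imp_iff, not_true_eq_false, false_imp_iff, and_true, if_true]
      constructor
      · rintro ⟨a, b, c, d⟩; exact ⟨by omega, a, d⟩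
      · rintro ⟨a, b, c⟩; exact ⟨b, by omega, by omega, c⟩
    · simp [he]

end Run

/-! ### The algorithm agrees with the scan -/

theorem mem_of_dtRun_eq_some {K N : ℕ} {thr : Fin K → ℕ → ℝ} {x : Equiv.Perm (Fin N)}
    {g : Fin N → Fin K} {l : List (Fin N)} {b : ℕ} {t : Fin N} (h : dtRun thr x g l b = some t) :
    t ∈ l := by
  induction l generalizing b with
  | nil => simp [dtRun] at h
  | cons a l ih =>
    cases b with
    | zero =>
      rw [dtRun] at h
      split_ifs at h
      · simp_all
      · exact List.mem_cons_of_mem _ (ih h)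
    | succ b =>
      rw [dtRun] at h
      split_ifs at h
      · simp_all
      · exact List.mem_cons_of_mem _ (ih h)
      · exact List.mem_cons_of_mem _ (ih h)

/-- Each allowed group record before `s` costs one unit of budget, and ends the run if it is the
best so far or if no budget is left. Being the best so far, `s` is taken with or without a remaining
comparison, hence the bound `≤ b`. -/
theorem dtRun_eq_some_iff {K N : ℕ} {thr : Fin K → ℝ} {x : Equiv.Perm (Fin N)}
    {g : Fin N → Fin K} {l₁ l₂ : List (Fin N)} {b : ℕ} {s : Fin N} (h₁ : s ∉ l₁) (h₂ : s ∉ l₂)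
    (hs : overallRank x s = 1) (p : Fin N → Prop) [DecidablePred p]
    (hp : ∀ t, p t ↔ ⌊thr (g t) * N⌋₊ ≤ (t : ℕ) + 1 ∧ inGroupRank x g t = 1) :
    dtRun (fun k _ => thr k) x g (l₁ ++ s :: l₂) b = some s ↔
      p s ∧ (l₁.filter p).length ≤ b ∧ ∀ t ∈ l₁, p t → overallRank x t ≠ 1 := by
  induction l₁ generalizing b with
  | nil =>
    have h3 : ∀ b, dtRun (fun k _ => thr k) x g l₂ b ≠ some s := fun b h =>
      h₂ (mem_of_dtRun_eq_some h)
    cases b <;> by_cases h4 : p s <;> simp [dtRun, ← hp, h4, hs, h3]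
  | cons a l ih =>
    simp only [List.mem_cons, not_or] at h₁
    have ih' := fun b => ih (b := b) h₁.2
    rw [List.cons_append]
    cases b with
    | zero =>
      rw [dtRun]
      simp only [← hp]
      by_cases h4 : p a
      · simp [h4, Ne.symm h₁.1]
      · simp [h4, ih']
    | succ b =>
      rw [dtRun]
      simp only [← hp]
      by_cases h4 : p a
      · by_cases h5 : overallRank x a = 1
        · simp [h4, h5, Ne.symm h₁.1]
        · simp [h4, h5, ih']
      · simp [h4, ih']

theorem overallRank_eq_one_iff {N : ℕ} (x : Equiv.Perm (Fin N)) (t : Fin N) :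
    overallRank x t = 1 ↔ ∀ s < t, x s < x t := by
  have h1 : t ∈ Finset.univ.filter fun s : Fin N => s ≤ t ∧ x t ≤ x s := by simp
  rw [overallRank, Finset.card_eq_one]
  constructor
  · rintro ⟨a, ha⟩ s hs
    by_contra h2
    have h3 : s ∈ Finset.univ.filter fun s : Fin N => s ≤ t ∧ x t ≤ x s := by
      simp [hs.le, not_lt.1 h2]
    rw [ha, Finset.mem_singleton] at h1 h3
    exact hs.ne (h3.trans h1.symm)
  · intro h2
    refine ⟨t, Finset.ext fun s => ?_⟩
    simp only [Finset.mem_filter, Finset.mem_univ, true_and, Finset.mem_singleton]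
    refine ⟨fun h3 => ?_, fun h3 => by simp [h3]⟩
    by_contra h4
    exact absurd (h2 s (lt_of_le_of_ne h3.1 h4)) (not_lt.2 h3.2)

theorem inGroupRank_eq_one_iff {K N : ℕ} (x : Equiv.Perm (Fin N)) (g : Fin N → Fin K) (t : Fin N) :
    inGroupRank x g t = 1 ↔ ∀ s < t, g s = g t → x s < x t := by
  have h1 : t ∈ Finset.univ.filter fun s : Fin N => s ≤ t ∧ x t ≤ x s ∧ g s = g t := by simp
  rw [inGroupRank, Finset.card_eq_one]
  constructor
  · rintro ⟨a, ha⟩ s hs hg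
    by_contra h2
    have h3 : s ∈ Finset.univ.filter fun s : Fin N => s ≤ t ∧ x t ≤ x s ∧ g s = g t := by
      simp [hs.le, not_lt.1 h2, hg]
    rw [ha, Finset.mem_singleton] at h1 h3
    exact hs.ne (h3.trans h1.symm)
  · intro h2
    refine ⟨t, Finset.ext fun s => ?_⟩
    simp only [Finset.mem_filter, Finset.mem_univ, true_and, Finset.mem_singleton]
    refine ⟨fun h3 => ?_, fun h3 => by simp [h3]⟩
    by_contra h4
    exact absurd (h2 s (lt_of_le_of_ne h3.1 h4) h3.2.2) (not_lt.2 h3.2.1)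

theorem dtSucceeds_iff_of_isMax {K N : ℕ} {thr : Fin K → ℝ} {B : ℕ} {x : Equiv.Perm (Fin N)}
    {g : Fin N → Fin K} {s : Fin N} (hs : ∀ t, x t ≤ x s) (p : Fin N → Prop)
    (hp : ∀ t, p t ↔ ⌊thr (g t) * N⌋₊ ≤ (t : ℕ) + 1 ∧ ∀ s < t, g s = g t → x s < x t)
    {A : Finset (Fin N)} (hA : ∀ t, t ∈ A ↔ t < s ∧ p t) :
    DTSucceeds (fun k _ => thr k) B x g ↔
      p s ∧ A.card ≤ B ∧ ∀ t < s, p t → ∃ u < t, x t < x u := by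
  classical
  have h1 : DTSucceeds (fun k _ => thr k) B x g ↔
      dtRun (fun k _ => thr k) x g (List.finRange N) B = some s := by
    constructor
    · rintro ⟨t, ht, hmax⟩
      rwa [← x.injective (le_antisymm (hs t) (hmax s))]
    · exact fun h => ⟨s, h, hs⟩
  obtain ⟨l₁, l₂, hl⟩ := List.append_of_mem (List.mem_finRange s)
  have hpw : (List.finRange N).Pairwise (· < ·) := List.pairwise_lt_finRange N
  have hmem : ∀ t, t ∈ l₁ ∨ t = s ∨ t ∈ l₂ := fun t => by
    have := List.mem_finRange t
    rw [hl] at this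
    simpa using this
  rw [hl, List.pairwise_append, List.pairwise_cons] at hpw
  obtain ⟨hp1, ⟨hp2, -⟩, hp3⟩ := hpw
  have hlt : ∀ t, t ∈ l₁ ↔ t < s := by
    refine fun t => ⟨fun h => hp3 t h s List.mem_cons_self, fun h => ?_⟩
    rcases hmem t with h2 | rfl | h2
    · exact h2
    · exact absurd h (lt_irrefl _)
    · exact absurd h (hp2 t h2).not_gt
  have hcard : A.card = (l₁.filter p).length := by
    rw [← List.toFinset_card_of_nodup ((hp1.imp fun h => h.ne).filter _)]
    congr 1
    ext t
    simp [hlt, hA]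
  rw [h1, hl, dtRun_eq_some_iff (fun h => lt_irrefl _ ((hlt s).1 h))
    (fun h => lt_irrefl _ (hp2 s h)) ?_ p (by simpa only [inGroupRank_eq_one_iff] using hp), hcard]
  · simp only [hlt, ne_eq, overallRank_eq_one_iff, not_forall, not_lt]
    refine and_congr_right fun _ => and_congr_right fun _ => forall_congr' fun t =>
      forall_congr' fun _ => forall_congr' fun _ => exists_congr fun u => ?_
    rw [exists_prop]
    exact and_congr_right fun hu => ⟨fun h => lt_of_le_of_ne h fun h' => hu.ne (x.injective h').symm,
      le_of_lt⟩
  · rw [overallRank_eq_one_iff]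
    exact fun t ht => lt_of_le_of_ne (hs t) fun h' => ht.ne (x.injective h')

/-- Among `N` candidates, the (zero-based) time `t` is late enough to stop at a candidate of
group `k`. -/
def discreteOk {K : ℕ} (thr : Fin K → ℝ) (N : ℕ) (t : ℕ) (k : Fin K) : Prop :=
  ⌊thr k * N⌋₊ ≤ t + 1

/-- Here `σ j` is the arrival time of the `j`-th best candidate, counted from `0`; the reversal
appears because larger values are better. Being a group record at one's arrival means that all
better members of the group arrive later, which is how eligibility is expressed along the list. -/
theorem dtSucceeds_iff_succ {K N : ℕ} {thr : Fin K → ℝ} {B : ℕ} {σ : Equiv.Perm (Fin N)}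
    {g : Fin N → Fin K} (hN : 0 < N) :
    DTSucceeds (fun k _ => thr k) B (σ.symm.trans Fin.revPerm) g ↔
      Succ (discreteOk thr N) B (List.ofFn fun j : Fin N => ((σ j : ℕ), g (σ j))) := by
  classical
  obtain ⟨n, rfl⟩ : ∃ n, N = n + 1 := ⟨N - 1, by omega⟩
  have hx : ∀ t, (σ.symm.trans Fin.revPerm) t = Fin.rev (σ.symm t) := fun t => rfl
  rw [dtSucceeds_iff_of_isMax (s := σ 0) (by simp [hx, Fin.le_last])
    (fun t => ⌊thr (g t) * (n + 1 : ℕ)⌋₊ ≤ (t : ℕ) + 1 ∧ ∀ s < t, g s = g t →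
      (σ.symm.trans Fin.revPerm) s < (σ.symm.trans Fin.revPerm) t) (fun t => Iff.rfl)
    (fun t => Finset.mem_filter_univ t),
    List.ofFn_succ, Succ, run_ofFn]
  have h0 : ∀ s, s < σ 0 → g s = g (σ 0) → (σ.symm.trans Fin.revPerm) s <
      (σ.symm.trans Fin.revPerm) (σ 0) := by
    intro s hs _
    rw [hx, hx, Fin.rev_lt_rev, Equiv.symm_apply_apply, Fin.pos_iff_ne_zero]
    rintro h1
    rw [← h1, Equiv.apply_symm_apply] at hs
    exact lt_irrefl _ hs
  have key : ∀ i : Fin n, (σ i.succ < σ 0 ∧ ⌊thr (g (σ i.succ)) * (n + 1 : ℕ)⌋₊ ≤ (σ i.succ : ℕ) + 1 ∧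
      ∀ s < σ i.succ, g s = g (σ i.succ) → (σ.symm.trans Fin.revPerm) s <
      (σ.symm.trans Fin.revPerm) (σ i.succ)) ↔ Elig (discreteOk thr (n + 1)) (fun _ => (σ 0 : ℕ))
        (fun i : Fin n => ((σ i.succ : ℕ), g (σ i.succ))) i := by
    intro i
    unfold Elig discreteOk
    rw [and_left_comm]
    refine and_congr_right fun _ => and_congr_right fun h1 => ?_
    simp only [hx, Equiv.symm_apply_apply, Fin.rev_lt_rev]
    constructor
    · intro h2 j hj hg
      by_contra h3
      have h4 : σ j.succ < σ i.succ := lt_of_le_of_ne (not_lt.1 h3) fun h => by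
        have := σ.injective h
        simp only [Fin.succ_inj] at this
        exact hj.ne this
      have := h2 _ h4 hg
      rw [Equiv.symm_apply_apply, Fin.succ_lt_succ_iff] at this
      exact absurd hj this.not_gt
    · intro h2 s hs hg
      by_contra h3
      obtain ⟨j, rfl⟩ := σ.surjective s
      rw [Equiv.symm_apply_apply, not_lt] at h3
      rcases Fin.eq_zero_or_eq_succ j with rfl | ⟨j, rfl⟩
      · exact absurd hs h1.not_gt
      · have h4 : j < i := lt_of_le_of_ne (Fin.succ_le_succ_iff.1 h3) fun h => by
          subst h; exact lt_irrefl _ hs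
        exact absurd hs (h2 j h4 hg).not_gt
  refine and_congr (and_iff_left h0) (and_congr ?_ ?_)
  · refine iff_of_eq (congrArg (· ≤ B)
      (Finset.card_bij (fun (i : Fin n) _ => σ i.succ) ?_ ?_ ?_).symm)
    · intro i hi
      exact Finset.mem_filter.2 ⟨Finset.mem_univ _, (key i).2 (Finset.mem_filter.1 hi).2⟩
    · intro i _ j _ hij
      exact Fin.succ_injective _ (σ.injective hij)
    · intro t ht
      obtain ⟨j, rfl⟩ := σ.surjective t
      have ht := (Finset.mem_filter.1 ht).2
      rcases Fin.eq_zero_or_eq_succ j with rfl | ⟨j, rfl⟩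
      · exact absurd ht.1 (lt_irrefl _)
      · exact ⟨j, Finset.mem_filter.2 ⟨Finset.mem_univ _, (key j).1 ht⟩, rfl⟩
  · constructor
    · intro h1 i hi
      have h2 := (key i).2 hi
      obtain ⟨u, hu, hxu⟩ := h1 _ h2.1 h2.2
      obtain ⟨j, rfl⟩ := σ.surjective u
      rw [hx, hx, Fin.rev_lt_rev, Equiv.symm_apply_apply, Equiv.symm_apply_apply] at hxu
      rcases Fin.eq_zero_or_eq_succ j with rfl | ⟨j, rfl⟩
      · exact absurd h2.1 hu.not_gt
      · exact Or.inr ⟨j, Fin.succ_lt_succ_iff.1 hxu, hu⟩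
    · intro h1 t ht1 ht2
      obtain ⟨i, rfl⟩ := σ.surjective t
      rcases Fin.eq_zero_or_eq_succ i with rfl | ⟨i, rfl⟩
      · exact absurd ht1 (lt_irrefl _)
      · have hi := (key i).1 ⟨ht1, ht2⟩
        rcases h1 i hi with ⟨k, hk⟩ | ⟨j, hj, hji⟩
        · exact absurd hi.2.1 hk.not_gt
        · refine ⟨σ j.succ, hji, ?_⟩
          rw [hx, hx, Fin.rev_lt_rev, Equiv.symm_apply_apply, Equiv.symm_apply_apply]
          exact Fin.succ_lt_succ_iff.2 hj

/-! ### From uniform integer times to uniform times in `(0, 1)` -/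

open MeasureTheory
open scoped ENNReal

open Classical in
/-- Probability that the list of `m` independent pairs `(u, k)`, with `u` uniform on `(0, 1)` and `k` of
law `p`, satisfies `A`. -/
noncomputable def contProb {K : ℕ} (p : Fin K → ℝ) : ℕ → (List (ℝ × Fin K) → Prop) → ℝ≥0∞
  | 0, A => if A [] then 1 else 0
  | m + 1, A => ∫⁻ u in Set.Ioo (0 : ℝ) 1,
      ∑ k, ENNReal.ofReal (p k) * contProb p m fun l => A ((u, k) :: l)

open Classical in
/-- Probability that the list of `m` independent pairs `(t, k)`, with `t` uniform on `{0, …, N - 1}`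
and `k` of law `p`, satisfies `A`. -/
noncomputable def discProb {K : ℕ} (p : Fin K → ℝ) (N : ℕ) : ℕ → (List (ℕ × Fin K) → Prop) → ℝ
  | 0, A => if A [] then 1 else 0
  | m + 1, A => 1 / (N : ℝ) * ∑ t ∈ Finset.range N,
      ∑ k, p k * discProb p N m fun l => A ((t, k) :: l)

section

variable {K : ℕ} {p : Fin K → ℝ}

theorem contProb_mono {m : ℕ} {A A' : List (ℝ × Fin K) → Prop} (h : ∀ l, A l → A' l) :
    contProb p m A ≤ contProb p m A' := by
  induction m generalizing A A' with
  | zero =>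
    simp only [contProb]
    by_cases h1 : A []
    · simp [h1, h _ h1]
    · simp [h1]
  | succ m ih =>
    simp only [contProb]
    gcongr
    exact ih fun l => h _

theorem contProb_true (hp : ∀ k, 0 ≤ p k) (hp1 : ∑ k, p k = 1) (m : ℕ) :
    contProb p m (fun _ => True) = 1 := by
  induction m with
  | zero => simp [contProb]
  | succ m ih =>
    simp only [contProb, ih, mul_one]
    rw [← ENNReal.ofReal_sum_of_nonneg fun k _ => hp k, hp1]
    simp

theorem contProb_of_forall (hp : ∀ k, 0 ≤ p k) (hp1 : ∑ k, p k = 1) {m : ℕ}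
    {A : List (ℝ × Fin K) → Prop} (h : ∀ l, A l) : contProb p m A = 1 := by
  rw [← contProb_true hp hp1 m]
  congr
  funext l
  simp [h l]

theorem contProb_le_one (hp : ∀ k, 0 ≤ p k) (hp1 : ∑ k, p k = 1) (m : ℕ)
    (A : List (ℝ × Fin K) → Prop) : contProb p m A ≤ 1 := by
  rw [← contProb_true hp hp1 m]
  exact contProb_mono fun _ _ => trivial

theorem discProb_nonneg (hp : ∀ k, 0 ≤ p k) (N m : ℕ) (A : List (ℕ × Fin K) → Prop) :
    0 ≤ discProb p N m A := by
  induction m generalizing A with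
  | zero => rw [discProb]; split_ifs <;> norm_num
  | succ m ih =>
    rw [discProb]
    exact mul_nonneg (by positivity) (Finset.sum_nonneg fun t _ => Finset.sum_nonneg fun k _ =>
      mul_nonneg (hp k) (ih _))

theorem discProb_le_one (hp : ∀ k, 0 ≤ p k) (hp1 : ∑ k, p k = 1) (N m : ℕ)
    (A : List (ℕ × Fin K) → Prop) : discProb p N m A ≤ 1 := by
  induction m generalizing A with
  | zero => rw [discProb]; split_ifs <;> norm_num
  | succ m ih =>
    rw [discProb]
    have h1 : ∀ t, ∑ k, p k * discProb p N m (fun l => A ((t, k) :: l)) ≤ 1 := fun t => by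
      rw [← hp1]
      exact Finset.sum_le_sum fun k _ => mul_le_of_le_one_right (hp k) (ih _)
    calc _ ≤ 1 / (N : ℝ) * ∑ t ∈ Finset.range N, 1 := by
          gcongr with t _
          exact h1 t
      _ ≤ 1 := by
          simp only [Finset.sum_const, Finset.card_range, nsmul_eq_mul, mul_one, one_div]
          exact inv_mul_le_one

/-- If `u` is uniform on `(0, 1)`, then `⌊N u⌋` is uniform on `{0, …, N - 1}`. All the discrete
models thus live on one space, where dominated convergence applies. -/
theorem lintegral_floor {N : ℕ} (hN : 0 < N) (G : ℕ → ℝ≥0∞) :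
    ∫⁻ u in Set.Ioo (0 : ℝ) 1, G ⌊N * u⌋₊ =
      ENNReal.ofReal (1 / (N : ℝ)) * ∑ t ∈ Finset.range N, G t := by
  have hN' : (0 : ℝ) < N := by exact_mod_cast hN
  have hU : Set.Ico (0 : ℝ) 1 = ⋃ t ∈ Finset.range N, Set.Ico ((t : ℝ) / N) ((t + 1 : ℝ) / N) := by
    ext u
    simp only [Set.mem_Ico, Set.mem_iUnion, Finset.mem_range, exists_prop]
    constructor
    · rintro ⟨h0, h1⟩
      refine ⟨⌊N * u⌋₊, ?_, ?_, ?_⟩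
      · rw [Nat.floor_lt (by positivity)]
        nlinarith
      · rw [div_le_iff₀ hN', mul_comm]
        exact Nat.floor_le (by positivity)
      · rw [lt_div_iff₀ hN', mul_comm]
        exact Nat.lt_floor_add_one _
    · rintro ⟨t, ht, h1, h2⟩
      refine ⟨le_trans (by positivity) h1, h2.trans_le ?_⟩
      rw [div_le_one hN']
      exact_mod_cast ht
  rw [setLIntegral_congr Ioo_ae_eq_Ico, hU, lintegral_biUnion_finset, Finset.mul_sum]
  · refine Finset.sum_congr rfl fun t _ => ?_
    rw [setLIntegral_congr_fun (g := fun _ => G t) measurableSet_Ico, setLIntegral_const,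
      Real.volume_Ico, mul_comm]
    · congr 2
      ring
    · intro u hu
      have h0 : 0 ≤ u := le_trans (by positivity) hu.1
      have : ⌊N * u⌋₊ = t := by
        rw [Nat.floor_eq_iff (by positivity)]
        exact ⟨by rw [← div_le_iff₀' hN']; exact hu.1, by rw [← lt_div_iff₀' hN']; exact hu.2⟩
      simp only [this]
  · intro s _ t _ hst
    refine Set.disjoint_left.2 fun u hs ht => hst ?_
    rw [Set.mem_Ico, div_le_iff₀ hN', lt_div_iff₀ hN'] at hs ht
    have h1 : (s : ℝ) < t + 1 := by linarith
    have h2 : (t : ℝ) < s + 1 := by linarith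
    norm_cast at h1 h2
    omega
  · exact fun t _ => measurableSet_Ico

theorem ofReal_discProb_succ (hp : ∀ k, 0 ≤ p k) {N : ℕ} (hN : 0 < N) (m : ℕ)
    (A : List (ℕ × Fin K) → Prop) :
    ENNReal.ofReal (discProb p N (m + 1) A) = ∫⁻ u in Set.Ioo (0 : ℝ) 1, ∑ k, ENNReal.ofReal (p k) *
      ENNReal.ofReal (discProb p N m fun l => A ((⌊N * u⌋₊, k) :: l)) := by
  have h1 : ∀ t k, 0 ≤ p k * discProb p N m fun l => A ((t, k) :: l) := fun t k =>
    mul_nonneg (hp k) (discProb_nonneg hp _ _ _)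
  rw [lintegral_floor hN fun t => ∑ k, ENNReal.ofReal (p k) *
      ENNReal.ofReal (discProb p N m fun l => A ((t, k) :: l)), discProb,
    ENNReal.ofReal_mul (by positivity),
    ENNReal.ofReal_sum_of_nonneg fun t _ => Finset.sum_nonneg fun k _ => h1 t k]
  congr 1
  refine Finset.sum_congr rfl fun t _ => ?_
  rw [ENNReal.ofReal_sum_of_nonneg fun k _ => h1 t k]
  exact Finset.sum_congr rfl fun k _ => ENNReal.ofReal_mul (hp k)

/-- Dominated convergence, one coordinate at a time, with bound `1`. Only the integrands at finite
`N` have to be shown measurable, and they are functions of `⌊N u⌋`; nothing is asked of `A'`. -/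
theorem tendsto_discProb (hp : ∀ k, 0 ≤ p k) (hp1 : ∑ k, p k = 1) (m : ℕ) {Z : Set ℝ}
    (hZ : Z.Countable) {A : ℕ → List (ℕ × Fin K) → Prop} {A' : List (ℝ × Fin K) → Prop}
    (h : ∀ l, l.length = m → (∀ x ∈ l, x.1 ∈ Set.Ioo 0 1 ∧ x.1 ∉ Z) → (l.map Prod.fst).Nodup →
      ∀ᶠ N : ℕ in atTop, (A N (l.map fun x : ℝ × Fin K => (⌊(N : ℝ) * x.1⌋₊, x.2)) ↔ A' l)) :
    Tendsto (fun N => ENNReal.ofReal (discProb p N m (A N))) atTop (𝓝 (contProb p m A')) := by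
  induction m generalizing Z A A' with
  | zero =>
    have h1 := h [] rfl (by simp) (by simp)
    refine tendsto_const_nhds.congr' ?_
    filter_upwards [h1] with N hN
    simp only [List.map_nil] at hN
    simp only [contProb, discProb]
    by_cases h3 : A' []
    · simp [h3, hN.2 h3]
    · simp [h3, mt hN.1 h3]
  | succ m ih =>
    rw [contProb]
    have h2 : Tendsto (fun N : ℕ => ∫⁻ u in Set.Ioo (0 : ℝ) 1, ∑ k, ENNReal.ofReal (p k) *
        ENNReal.ofReal (discProb p N m fun l => A N ((⌊N * u⌋₊, k) :: l))) atTop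
        (𝓝 (∫⁻ u in Set.Ioo (0 : ℝ) 1,
          ∑ k, ENNReal.ofReal (p k) * contProb p m fun l => A' ((u, k) :: l))) := by
      refine tendsto_lintegral_of_dominated_convergence (fun _ => 1) ?_ ?_ (by simp) ?_
      · intro N
        exact (measurable_from_nat (f := fun t => ∑ k, ENNReal.ofReal (p k) *
          ENNReal.ofReal (discProb p N m fun l => A N ((t, k) :: l)))).comp
          (Nat.measurable_floor.comp (measurable_const.mul measurable_id))
      · refine fun N => Eventually.of_forall fun u => ?_
        calc _ ≤ ∑ k, ENNReal.ofReal (p k) := by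
              refine Finset.sum_le_sum fun k _ => mul_le_of_le_one_right (by simp) ?_
              rw [ENNReal.ofReal_le_one]
              exact discProb_le_one hp hp1 _ _ _
          _ = 1 := by rw [← ENNReal.ofReal_sum_of_nonneg fun k _ => hp k, hp1]; simp
      · have hae : ∀ᵐ u ∂(volume.restrict (Set.Ioo (0 : ℝ) 1)), u ∈ Set.Ioo (0 : ℝ) 1 ∧ u ∉ Z :=
          (ae_restrict_mem measurableSet_Ioo).and
            (ae_restrict_of_ae (hZ.ae_notMem _))
        filter_upwards [hae] with u hu
        refine tendsto_finsetSum _ fun k _ => ENNReal.Tendsto.const_mul ?_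
          (Or.inr ENNReal.ofReal_ne_top)
        -- Adding `u` to the exceptional set makes all later times differ from `u`, which provides
        -- distinctness.
        refine ih (hZ.insert u) fun l hl hl1 hl2 => ?_
        refine h ((u, k) :: l) (by simp [hl]) ?_ ?_
        · intro x hx
          rcases List.mem_cons.1 hx with rfl | hx
          · exact hu
          · exact ⟨(hl1 x hx).1, fun h => (hl1 x hx).2 (Or.inr h)⟩
        · rw [List.map_cons, List.nodup_cons]
          refine ⟨fun hmem => ?_, hl2⟩
          obtain ⟨x, hx, hxu⟩ := List.mem_map.1 hmem
          exact (hl1 x hx).2 (Or.inl hxu)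
    refine h2.congr' ?_
    filter_upwards [eventually_gt_atTop 0] with N hN
    exact (ofReal_discProb_succ hp hN m _).symm

end

/-- The extra `+ 1` absorbs the shift between time index and step in `discreteOk`. -/
theorem eventually_floor_mul_lt {u v : ℝ} (hu : 0 ≤ u) (huv : u < v) :
    ∀ᶠ N : ℕ in atTop, ⌊(N : ℝ) * u⌋₊ + 1 < ⌊v * (N : ℝ)⌋₊ := by
  have h1 : Tendsto (fun N : ℕ => (N : ℝ) * (v - u)) atTop atTop :=
    tendsto_natCast_atTop_atTop.atTop_mul_const (sub_pos.2 huv)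
  filter_upwards [h1.eventually_ge_atTop 3] with N hN
  have h2 := Nat.floor_le (mul_nonneg (Nat.cast_nonneg N) hu)
  have h3 := Nat.lt_floor_add_one (v * (N : ℝ))
  have h4 : ((⌊(N : ℝ) * u⌋₊ + 1 : ℕ) : ℝ) < (⌊v * (N : ℝ)⌋₊ : ℕ) := by
    push_cast
    nlinarith
  exact_mod_cast h4

theorem eventually_pattern {K : ℕ} (thr : Fin K → ℝ) {l : List (ℝ × Fin K)}
    (h : ∀ x ∈ l, x.1 ∈ Set.Ioo 0 1 ∧ x.1 ∉ Set.range thr) :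
    ∀ᶠ N : ℕ in atTop, StrictMonoOn (fun u : ℝ => ⌊(N : ℝ) * u⌋₊) {u | ∃ x ∈ l, x.1 = u} ∧
      ∀ t ∈ {u | ∃ x ∈ l, x.1 = u}, ∀ k, discreteOk thr N ⌊(N : ℝ) * t⌋₊ k ↔ thr k ≤ t := by
  have hfin : {u | ∃ x ∈ l, x.1 = u}.Finite := by
    refine ((l.map Prod.fst).finite_toSet).subset ?_
    rintro u ⟨x, hx, rfl⟩
    exact List.mem_map_of_mem hx
  have hpos : ∀ u ∈ {u | ∃ x ∈ l, x.1 = u}, (0 : ℝ) ≤ u := by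
    rintro u ⟨x, hx, rfl⟩
    exact (h x hx).1.1.le
  refine Eventually.and ?_ ?_
  · have h1 : ∀ u ∈ {u | ∃ x ∈ l, x.1 = u}, ∀ v ∈ {u | ∃ x ∈ l, x.1 = u},
        ∀ᶠ N : ℕ in atTop, u < v → ⌊(N : ℝ) * u⌋₊ < ⌊(N : ℝ) * v⌋₊ := by
      intro u hu v _
      by_cases huv : u < v
      · filter_upwards [eventually_floor_mul_lt (hpos u hu) huv] with N hN _
        rw [mul_comm _ v]
        omega
      · exact Eventually.of_forall fun N h => absurd h huv
    have h2 := (eventually_all_finite hfin).2 fun u hu => (eventually_all_finite hfin).2 (h1 u hu)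
    filter_upwards [h2] with N hN u hu v hv huv
    exact hN u hu v hv huv
  · refine (eventually_all_finite hfin).2 fun u hu => eventually_all.2 fun k => ?_
    unfold discreteOk
    rcases lt_trichotomy u (thr k) with h1 | h1 | h1
    · filter_upwards [eventually_floor_mul_lt (hpos u hu) h1] with N hN
      exact iff_of_false (by omega) (not_le.2 h1)
    · obtain ⟨x, hx, rfl⟩ := hu
      exact absurd ⟨k, h1.symm⟩ (h x hx).2
    · refine Eventually.of_forall fun N => iff_of_true ?_ h1.le
      refine le_trans ?_ (Nat.le_succ _)
      exact Nat.floor_le_floor (by rw [mul_comm]; gcongr)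

/-! ### Integrals of the truncated exponential series in `log (u / β)` -/

/-- `logSum β n u` is the partial sum of length `n` of the exponential series at `log (u / β)`. -/
noncomputable def logSum (β : ℝ) (n : ℕ) (u : ℝ) : ℝ :=
  ∑ l ∈ Finset.range n, Real.log (u / β) ^ l / (l.factorial : ℝ)

theorem logSum_self {β : ℝ} (hβ : 0 < β) (n : ℕ) : logSum β (n + 1) β = 1 := by
  rw [logSum, Finset.sum_range_succ']
  simp [div_self hβ.ne']

theorem logSum_nonneg {β u : ℝ} (hβ : 0 < β) (hu : β ≤ u) (n : ℕ) : 0 ≤ logSum β n u := by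
  have : 0 ≤ Real.log (u / β) := Real.log_nonneg (by rw [le_div_iff₀ hβ]; linarith)
  exact Finset.sum_nonneg fun l _ => by positivity

theorem logSum_le {β u : ℝ} (hβ : 0 < β) (hu : β ≤ u) (n : ℕ) : logSum β n u ≤ u / β := by
  have h1 := sum_log_pow_le (w := β / u) (div_pos hβ (hβ.trans_le hu))
    (by rw [div_le_one (hβ.trans_le hu)]; exact hu) n
  rwa [one_div_div] at h1

theorem hasDerivAt_logSum {β u : ℝ} (hβ : 0 < β) (hu : 0 < u) (n : ℕ) :
    HasDerivAt (logSum β (n + 1)) (1 / u * logSum β n u) u := by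
  have h0 : HasDerivAt (fun u => Real.log (u / β)) (1 / u) u := by
    have := ((hasDerivAt_id u).div_const β).log (by simp [hu.ne', hβ.ne'])
    refine this.congr_deriv ?_
    simp only [id]
    field_simp
  have h1 : HasDerivAt (fun u => ∑ l ∈ Finset.range n,
      Real.log (u / β) ^ (l + 1) / ((l + 1).factorial : ℝ) + 1) (1 / u * logSum β n u) u := by
    refine HasDerivAt.add_const 1 ?_
    rw [logSum, Finset.mul_sum]
    refine HasDerivAt.fun_sum fun l _ => ?_
    refine ((h0.fun_pow (l + 1)).div_const _).congr_deriv ?_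
    rw [Nat.factorial_succ]
    push_cast
    field_simp
  refine h1.congr_of_eventuallyEq (Eventually.of_forall fun u => ?_)
  simp [logSum, Finset.sum_range_succ' _ n]

theorem continuousOn_logSum {β : ℝ} (hβ : 0 < β) (n : ℕ) :
    ContinuousOn (logSum β n) (Set.Ioi 0) := by
  cases n with
  | zero => exact (continuousOn_const (c := (0 : ℝ))).congr fun u _ => by simp [logSum]
  | succ n => exact fun u hu => (hasDerivAt_logSum hβ hu n).continuousAt.continuousWithinAt

theorem integral_logSum {β f : ℝ} (hβ : 0 < β) (hf : β ≤ f) (n : ℕ) :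
    ∫ u in β..f, 1 / u * logSum β n u = logSum β (n + 1) f - 1 := by
  have hsub : Set.uIcc β f ⊆ Set.Ioi 0 := by
    rw [Set.uIcc_of_le hf]
    exact fun u hu => hβ.trans_le hu.1
  rw [intervalIntegral.integral_eq_sub_of_hasDerivAt
    (fun u hu => hasDerivAt_logSum hβ (hsub hu) n), logSum_self hβ]
  refine ContinuousOn.intervalIntegrable ?_
  exact ((continuousOn_const.div continuousOn_id fun u hu => (ne_of_gt hu)).mul
    (continuousOn_logSum hβ n)).mono hsub

theorem integral_logSum_div_sq {β : ℝ} (hβ : 0 < β) (hβ1 : β ≤ 1) (B : ℕ) :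
    ∫ u in β..1, 1 / u ^ 2 * logSum β (B + 1) u = S B β := by
  have hsub : Set.uIcc β 1 ⊆ Set.Ioi 0 := by
    rw [Set.uIcc_of_le hβ1]
    exact fun u hu => hβ.trans_le hu.1
  -- The derivative of `-(logSum β (b + 1) u) / u` is `log (u / β)^b / b! / u²`, and summing over `b
  -- ≤ B` restores the integrand.
  rw [intervalIntegral.integral_eq_sub_of_hasDerivAt
    (f := fun u => ∑ b ∈ Finset.range (B + 1), -(u⁻¹ * logSum β (b + 1) u))]
  · simp only [logSum_self hβ]
    rw [S, ← Finset.sum_sub_distrib]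
    refine Finset.sum_congr rfl fun b _ => ?_
    rw [logSum]
    ring
  · intro u hu
    have hu0 : 0 < u := hsub hu
    rw [logSum, Finset.mul_sum]
    refine HasDerivAt.fun_sum fun b _ => ?_
    refine (((hasDerivAt_inv hu0.ne').mul (hasDerivAt_logSum hβ hu0 b)).neg).congr_deriv ?_
    rw [logSum, Finset.sum_range_succ, ← logSum]
    field_simp
    ring
  · refine ContinuousOn.intervalIntegrable ?_
    exact ((continuousOn_const.div (continuousOn_id.pow 2) fun u hu => (pow_pos hu 2).ne').mul
      (continuousOn_logSum hβ _)).mono hsub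

/-! ### Lower bounds in the continuous model -/

theorem ofReal_intervalIntegral_le {a b : ℝ} (hab : a ≤ b) {g : ℝ → ℝ} {G : ℝ → ℝ≥0∞}
    (hg : ContinuousOn g (Set.Icc a b)) (hg0 : ∀ u ∈ Set.Ioo a b, 0 ≤ g u)
    (h : ∀ u ∈ Set.Ioo a b, ENNReal.ofReal (g u) ≤ G u) :
    ENNReal.ofReal (∫ u in a..b, g u) ≤ ∫⁻ u in Set.Ioo a b, G u := by
  rw [intervalIntegral.integral_of_le hab, integral_Ioc_eq_integral_Ioo,
    ofReal_integral_eq_lintegral_ofReal]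
  · exact setLIntegral_mono' measurableSet_Ioo h
  · exact (hg.integrableOn_Icc).mono_set Set.Ioo_subset_Icc_self
  · exact (ae_restrict_iff' measurableSet_Ioo).2 (Eventually.of_forall hg0)

theorem lintegral_Ioo_add_le {a b c : ℝ} (hab : a ≤ b) (hbc : b ≤ c) (G : ℝ → ℝ≥0∞) :
    (∫⁻ u in Set.Ioo a b, G u) + ∫⁻ u in Set.Ioo b c, G u ≤ ∫⁻ u in Set.Ioo a c, G u := by
  have h1 : Disjoint (Set.Ioo a b) (Set.Ioo b c) :=
    Set.disjoint_left.2 fun u hu hu' => (hu.2.trans hu'.1).false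
  rw [← lintegral_union measurableSet_Ioo h1]
  refine lintegral_mono_set (Set.union_subset ?_ ?_)
  · exact Set.Ioo_subset_Ioo_right hbc
  · exact Set.Ioo_subset_Ioo_left hab

theorem ofReal_add_le_lintegral_Ioo {a b c x y : ℝ} (hab : a ≤ b) (hbc : b ≤ c) {G : ℝ → ℝ≥0∞}
    (hx : ENNReal.ofReal x ≤ ∫⁻ u in Set.Ioo a b, G u)
    (hy : ENNReal.ofReal y ≤ ∫⁻ u in Set.Ioo b c, G u) :
    ENNReal.ofReal (x + y) ≤ ∫⁻ u in Set.Ioo a c, G u :=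
  ENNReal.ofReal_add_le.trans ((add_le_add hx hy).trans (lintegral_Ioo_add_le hab hbc G))

theorem ofReal_mul_le_lintegral_Ioo {a b x : ℝ} (hab : a ≤ b) {G : ℝ → ℝ≥0∞}
    (h : ∀ u ∈ Set.Ioo a b, ENNReal.ofReal x ≤ G u) :
    ENNReal.ofReal ((b - a) * x) ≤ ∫⁻ u in Set.Ioo a b, G u := by
  rw [ENNReal.ofReal_mul (sub_nonneg.2 hab), mul_comm, ← Real.volume_Ioo, ← setLIntegral_const]
  exact setLIntegral_mono' measurableSet_Ioo h

theorem sum_fin_two_of_ne {M : Type*} [AddCommMonoid M] {k k' : Fin 2} (hk : k ≠ k')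
    (a : Fin 2 → M) : ∑ i, a i = a k' + a k := by
  fin_cases k <;> fin_cases k' <;> simp_all [add_comm]

theorem ofReal_le_sum_mul {p : Fin 2 → ℝ} (hp : ∀ k, 0 ≤ p k) {k k' : Fin 2} (hk : k ≠ k')
    {C : Fin 2 → ℝ≥0∞} {x y : ℝ} (hx : ENNReal.ofReal x ≤ C k') (hy : ENNReal.ofReal y ≤ C k) :
    ENNReal.ofReal (p k' * x + p k * y) ≤ ∑ i, ENNReal.ofReal (p i) * C i := by
  rw [sum_fin_two_of_ne hk]
  refine ENNReal.ofReal_add_le.trans ?_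
  rw [ENNReal.ofReal_mul (hp _), ENNReal.ofReal_mul (hp _)]
  gcongr

/-- Stopping at time `u ∈ [0, 1]` at a candidate of group `k` is allowed. -/
def contOk {K : ℕ} (thr : Fin K → ℝ) (u : ℝ) (k : Fin K) : Prop := thr k ≤ u

/-- Group `k'` is settled by a candidate arriving at `F k'`, so only group `k` can consume budget,
and after `β` every comparison reveals that better candidate. The next member of `k` before `f = F
k` is uniform on `(0, f)`: before `thr k` it settles the group, between `thr k` and `β` it is
counted as a loss, after `β` it costs one unit. The recursion `V_c(f) = (thr k + ∫_β^f V_{c-1}) / f`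
is solved by the stated value. Adding the event that no listed member of `k` precedes its threshold
makes the bound valid for every `m`, starting trivially at `m = 0`. -/
theorem le_contProb_run {p thr : Fin 2 → ℝ} (hp : ∀ k, 0 ≤ p k) (hp1 : ∑ k, p k = 1)
    {k k' : Fin 2} (hk : k ≠ k') {β : ℝ} (h0 : 0 < thr k) (hβ : thr k ≤ β) (m : ℕ)
    {F : Fin 2 → ℝ} {c : ℕ} (hF : β ≤ F k) (hF1 : F k ≤ 1) (hF' : F k' ≤ thr k') (hFβ : F k' ≤ β) :
    ENNReal.ofReal (thr k / F k * logSum β (c + 1) (F k)) ≤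
      contProb p m fun l => Run (contOk thr) l F c ∨ ∀ x ∈ l, x.2 = k → thr k ≤ x.1 := by
  have hβ0 : 0 < β := h0.trans_le hβ
  have hp1' : p k' + p k = 1 := by rw [← sum_fin_two_of_ne hk]; exact hp1
  have hW1 : ∀ {f : ℝ}, β ≤ f → ∀ n, thr k / f * logSum β n f ≤ 1 := by
    intro f hf n
    have hf0 : 0 < f := hβ0.trans_le hf
    calc thr k / f * logSum β n f ≤ thr k / f * (f / β) := by gcongr; exact logSum_le hβ0 hf n
      _ = thr k / β := by field_simp
      _ ≤ 1 := by rwa [div_le_one hβ0]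
  induction m generalizing F c with
  | zero =>
    simp only [contProb, List.not_mem_nil, false_imp_iff, implies_true, or_true, if_true]
    rw [ENNReal.ofReal_le_one]
    exact hW1 hF _
  | succ m ih =>
    set f := F k with hf
    have hf0 : 0 < f := hβ0.trans_le hF
    set W := thr k / f * logSum β (c + 1) f with hW
    have hfW : f * W = thr k * logSum β (c + 1) f := by rw [hW]; field_simp
    have hk' : ∀ u, ENNReal.ofReal W ≤ contProb p m fun l => Run (contOk thr) ((u, k') :: l) F c ∨
        ∀ x ∈ (u, k') :: l, x.2 = k → thr k ≤ x.1 := by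
      intro u
      have h1 := ih (F := Function.update F k' (min (F k') u)) (c := c)
        (by rwa [Function.update_of_ne hk]) (by rwa [Function.update_of_ne hk])
        (by rw [Function.update_self]; exact (min_le_left _ _).trans hF')
        (by rw [Function.update_self]; exact (min_le_left _ _).trans hFβ)
      rw [Function.update_of_ne hk] at h1
      refine h1.trans (contProb_mono fun l hl => hl.imp (fun hl => ⟨fun h2 => ?_, fun _ => hl⟩) ?_)
      · exact absurd (h2.2.trans_le hF') (not_lt.2 h2.1)
      · intro hl x hx hxk
        rcases List.mem_cons.1 hx with rfl | hx
        · exact absurd hxk hk.symm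
        · exact hl x hx hxk
    have hlow : ∀ u, u < thr k → ENNReal.ofReal 1 ≤ contProb p m fun l =>
        Run (contOk thr) ((u, k) :: l) F c ∨ ∀ x ∈ (u, k) :: l, x.2 = k → thr k ≤ x.1 := by
      intro u hu
      rw [ENNReal.ofReal_one, contProb_of_forall hp hp1]
      refine fun l => Or.inl ⟨fun h => absurd h.1 (not_le.2 hu), fun _ => run_of_not_ok ?_⟩
      intro i t ht
      have hi : i = k ∨ i = k' := by
        fin_cases k <;> fin_cases k' <;> fin_cases i <;> simp_all
      rcases hi with rfl | rfl
      · rw [Function.update_self] at ht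
        exact not_le.2 ((ht.trans_le (min_le_right _ _)).trans hu)
      · rw [Function.update_of_ne hk.symm] at ht
        exact not_le.2 (ht.trans_le hF')
    have hmid : ∀ u ∈ Set.Ioo β f, ENNReal.ofReal (thr k * (1 / u * logSum β c u)) ≤
        contProb p m fun l => Run (contOk thr) ((u, k) :: l) F c ∨
          ∀ x ∈ (u, k) :: l, x.2 = k → thr k ≤ x.1 := by
      intro u hu
      cases c with
      | zero => simp [logSum]
      | succ c =>
        have hup : Function.update F k (min (F k) u) k = u := by
          rw [Function.update_self]; exact min_eq_right hu.2.le
        have h1 := ih (F := Function.update F k (min (F k) u)) (c := c)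
          (by rw [hup]; exact hu.1.le) (by rw [hup]; exact hu.2.le.trans hF1)
          (by rwa [Function.update_of_ne hk.symm]) (by rwa [Function.update_of_ne hk.symm])
        rw [hup, div_eq_mul_one_div, mul_assoc] at h1
        have hok : contOk thr u k ∧ u < F k := ⟨hβ.trans hu.1.le, hu.2⟩
        refine h1.trans (contProb_mono fun l hl => hl.imp (fun hl => ⟨fun h2 => ?_, fun h2 => ?_⟩) ?_)
        · exact ⟨⟨k', hFβ.trans_lt hu.1⟩, c.succ_pos, hl⟩
        · exact absurd hok h2
        · intro hl x hx hxk
          rcases List.mem_cons.1 hx with rfl | hx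
          · exact hok.1
          · exact hl x hx hxk
    have hhigh : ∀ u, f < u → ENNReal.ofReal W ≤ contProb p m fun l =>
        Run (contOk thr) ((u, k) :: l) F c ∨ ∀ x ∈ (u, k) :: l, x.2 = k → thr k ≤ x.1 := by
      intro u hu
      have hup : Function.update F k (min (F k) u) = F := by
        rw [min_eq_left hu.le, Function.update_eq_self]
      refine (ih (F := F) (c := c) hF hF1 hF' hFβ).trans (contProb_mono fun l hl =>
        hl.imp (fun hl => ⟨fun h2 => ?_, fun h2 => ?_⟩) ?_)
      · exact absurd h2.2 hu.not_gt
      · rwa [hup]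
      · intro hl x hx hxk
        rcases List.mem_cons.1 hx with rfl | hx
        · exact (hβ.trans hF).trans hu.le
        · exact hl x hx hxk
    have hcont : ContinuousOn (fun u : ℝ => 1 / u * logSum β c u) (Set.Icc β f) :=
      ((continuousOn_const.div continuousOn_id fun u hu => (ne_of_gt hu)).mul
        (continuousOn_logSum hβ0 c)).mono fun u hu => hβ0.trans_le hu.1
    have hint : ∫ u in β..f, (p k' * W + p k * (thr k * (1 / u * logSum β c u))) =
        (f - β) * (p k' * W) + p k * (thr k * (logSum β (c + 1) f - 1)) := by
      rw [intervalIntegral.integral_add, intervalIntegral.integral_const, smul_eq_mul,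
        intervalIntegral.integral_const_mul, intervalIntegral.integral_const_mul,
        integral_logSum hβ0 hF]
      · exact intervalIntegrable_const
      · refine ContinuousOn.intervalIntegrable ?_
        rw [Set.uIcc_of_le hF]
        exact (hcont.const_mul _).const_mul _
    -- Conditioning on the next entry, with `(0, 1)` cut at `thr k`, `β` and `f`. Entries of `k'`
    -- and entries after `f` leave the value `W` unchanged.
    have htotal : W = ((thr k - 0) * (p k' * W + p k * 1) + (β - thr k) * (p k' * W + p k * 0)) +
        ((∫ u in β..f, (p k' * W + p k * (thr k * (1 / u * logSum β c u)))) +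
          (1 - f) * (p k' * W + p k * W)) := by
      rw [hint]
      have : p k' = 1 - p k := by linarith
      rw [this]
      linear_combination p k * hfW
    have hWnn : 0 ≤ W := by
      have := logSum_nonneg hβ0 hF (c + 1)
      positivity
    rw [htotal, contProb]
    refine ofReal_add_le_lintegral_Ioo (hβ0.le) (hF.trans hF1)
      (ofReal_add_le_lintegral_Ioo h0.le hβ ?_ ?_) (ofReal_add_le_lintegral_Ioo hF hF1 ?_ ?_)
    · exact ofReal_mul_le_lintegral_Ioo h0.le fun u hu =>
        ofReal_le_sum_mul hp hk (hk' u) (hlow u hu.2)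
    · exact ofReal_mul_le_lintegral_Ioo hβ fun u hu =>
        ofReal_le_sum_mul hp hk (hk' u) (by simp)
    · refine ofReal_intervalIntegral_le hF ?_ (fun u hu => ?_) fun u hu =>
        ofReal_le_sum_mul hp hk (hk' u) (hmid u hu)
      · exact continuousOn_const.add ((hcont.const_mul _).const_mul _)
      · have h1 := logSum_nonneg hβ0 hu.1.le c
        have h2 : 0 < u := hβ0.trans hu.1
        have h3 := hp k
        have h4 := hp k'
        positivity
    · exact ofReal_mul_le_lintegral_Ioo hF1 fun u hu =>
        ofReal_le_sum_mul hp hk (hk' u) (hhigh u hu.1)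

/-- In some group, stopping is allowed at the arrival times of all listed candidates. -/
def Undecided {T : Type*} {K : ℕ} (ok : T → Fin K → Prop) (l : List (T × Fin K)) : Prop :=
  ∃ k, ∀ x ∈ l, x.2 = k → ok x.1 k

theorem Undecided.cons {T : Type*} {K : ℕ} {ok : T → Fin K → Prop} {l : List (T × Fin K)}
    (h : Undecided ok l) {u : T} {k : Fin K} (hu : ok u k) : Undecided ok ((u, k) :: l) := by
  obtain ⟨i, hi⟩ := h
  refine ⟨i, fun x hx hxi => ?_⟩
  rcases List.mem_cons.1 hx with rfl | hx
  · exact hxi ▸ hu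
  · exact hi x hx hxi

theorem undecided_cons_of_ne {K : ℕ} {thr : Fin K → ℝ} {l : List (ℝ × Fin K)} {i k : Fin K}
    (h : ∀ x ∈ l, x.2 = k → thr k ≤ x.1) (hik : i ≠ k) (u : ℝ) :
    Undecided (contOk thr) ((u, i) :: l) := by
  refine ⟨k, fun x hx hxk => ?_⟩
  rcases List.mem_cons.1 hx with rfl | hx
  · exact absurd hxk hik
  · exact h x hx hxk

theorem eq_or_eq_of_ne {k k' : Fin 2} (hk : k ≠ k') (i : Fin 2) : i = k ∨ i = k' := by
  fin_cases k <;> fin_cases k' <;> fin_cases i <;> simp_all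

section

variable {p thr : Fin 2 → ℝ} {k₁ k₂ : Fin 2}

/-- First candidate of the list before time `s`, of group `i`, arriving before its threshold. -/
theorem le_contProb_run_cons (hp : ∀ k, 0 ≤ p k) (hp1 : ∑ k, p k = 1) {i k : Fin 2}
    (hik : i ≠ k) {β : ℝ} (h0 : 0 < thr k) (hβ : thr k ≤ β) {s : ℝ} (hs : β ≤ s) (hs1 : s ≤ 1)
    (hiβ : thr i ≤ β) (B m : ℕ) {u : ℝ} (hu : u < thr i) :
    ENNReal.ofReal (thr k / s * logSum β (B + 1) s) ≤ contProb p m fun l =>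
      Run (contOk thr) ((u, i) :: l) (fun _ => s) B ∨ Undecided (contOk thr) ((u, i) :: l) := by
  have h1 := le_contProb_run hp hp1 hik.symm h0 hβ m
    (F := Function.update (fun _ => s) i (min s u)) (c := B)
    (by rwa [Function.update_of_ne hik.symm]) (by rwa [Function.update_of_ne hik.symm])
    (by rw [Function.update_self]; exact (min_le_right _ _).trans hu.le)
    (by rw [Function.update_self]; exact (min_le_right _ _).trans (hu.le.trans hiβ))
  rw [Function.update_of_ne hik.symm] at h1
  refine h1.trans (contProb_mono fun l hl => hl.imp (fun hl => ⟨fun h2 => ?_, fun _ => hl⟩)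
    fun hl => undecided_cons_of_ne hl hik u)
  exact absurd h2.1 (not_le.2 hu)

/-- The first entry before `s` is the best candidate before `s`, hence the best so far on arrival,
and must precede the threshold of its group `i`: probability `thr i / s`. The other group `k` then
contributes `thr k / s` times `logSum`. The product `α β / s²` is the same for both `i`, so the
proportions `p` drop out. -/
theorem le_contProb_run_const (hp : ∀ k, 0 ≤ p k) (hp1 : ∑ k, p k = 1) (hk : k₁ ≠ k₂)
    (h0 : 0 < thr k₁) (h12 : thr k₁ ≤ thr k₂) {s : ℝ} (hs : thr k₂ ≤ s) (hs1 : s ≤ 1) (B m : ℕ) :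
    ENNReal.ofReal (thr k₁ * thr k₂ * (1 / s ^ 2 * logSum (thr k₂) (B + 1) s)) ≤
      contProb p m fun l => Run (contOk thr) l (fun _ => s) B ∨ Undecided (contOk thr) l := by
  set α := thr k₁ with hα
  set β := thr k₂ with hβ
  have hβ0 : 0 < β := h0.trans_le h12
  have hs0 : 0 < s := hβ0.trans_le hs
  set Q := logSum β (B + 1) s with hQ
  have hQ0 : 0 ≤ Q := logSum_nonneg hβ0 hs _
  have hp1' : p k₁ + p k₂ = 1 := by rw [← sum_fin_two_of_ne hk.symm]; exact hp1
  set W := α * β * (1 / s ^ 2 * Q) with hW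
  induction m with
  | zero =>
    have h1 : Undecided (contOk thr) [] := ⟨k₁, by simp⟩
    simp only [contProb, h1, or_true, if_true]
    rw [ENNReal.ofReal_le_one]
    calc W ≤ α * β * (1 / s ^ 2 * (s / β)) := by
          rw [hW]; gcongr; exact logSum_le hβ0 hs _
      _ = α / s := by field_simp
      _ ≤ 1 := by rw [div_le_one hs0]; exact h12.trans hs
  | succ m ih =>
    have hall : ∀ i, ∀ u, s < u → ENNReal.ofReal W ≤ contProb p m fun l =>
        Run (contOk thr) ((u, i) :: l) (fun _ => s) B ∨ Undecided (contOk thr) ((u, i) :: l) := by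
      intro i u hu
      have hup : Function.update (fun _ : Fin 2 => s) i (min s u) = fun _ => s := by
        rw [min_eq_left hu.le]; exact Function.update_eq_self i _
      refine ih.trans (contProb_mono fun l hl =>
        hl.imp (fun hl => ⟨fun h2 => ?_, fun h2 => ?_⟩) fun hl => hl.cons ?_)
      · exact absurd h2.2 hu.not_gt
      · rwa [hup]
      · rcases eq_or_eq_of_ne hk i with rfl | rfl
        · exact (h12.trans hs).trans hu.le
        · exact hs.trans hu.le
    have h1 : ∀ u, u < α → ENNReal.ofReal (β / s * Q) ≤ contProb p m fun l =>
        Run (contOk thr) ((u, k₁) :: l) (fun _ => s) B ∨ Undecided (contOk thr) ((u, k₁) :: l) :=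
      fun u hu => le_contProb_run_cons hp hp1 hk hβ0 le_rfl hs hs1 h12 B m hu
    have h2 : ∀ u, u < β → ENNReal.ofReal (α / s * Q) ≤ contProb p m fun l =>
        Run (contOk thr) ((u, k₂) :: l) (fun _ => s) B ∨ Undecided (contOk thr) ((u, k₂) :: l) :=
      fun u hu => le_contProb_run_cons hp hp1 hk.symm h0 h12 hs hs1 le_rfl B m hu
    have hWs : W * s = α * β / s * Q := by rw [hW]; field_simp
    have htotal : W = ((α - 0) * (p k₂ * (α / s * Q) + p k₁ * (β / s * Q)) +
        (β - α) * (p k₂ * (α / s * Q) + p k₁ * 0)) + (1 - s) * (p k₂ * W + p k₁ * W) := by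
      have : p k₂ = 1 - p k₁ := by linarith
      rw [this]
      linear_combination hWs
    rw [htotal, contProb]
    refine (ofReal_add_le_lintegral_Ioo hs0.le hs1 ((ofReal_add_le_lintegral_Ioo h0.le h12 ?_ ?_).trans
      (lintegral_mono_set (Set.Ioo_subset_Ioo_right hs))) ?_)
    · exact ofReal_mul_le_lintegral_Ioo h0.le fun u hu =>
        ofReal_le_sum_mul hp hk (h2 u (hu.2.trans_le h12)) (h1 u hu.2)
    · exact ofReal_mul_le_lintegral_Ioo h12 fun u hu =>
        ofReal_le_sum_mul hp hk (h2 u hu.2) (by simp)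
    · exact ofReal_mul_le_lintegral_Ioo hs1 fun u hu =>
        ofReal_le_sum_mul hp hk (hall _ u hu.1) (hall _ u hu.1)

/-- Conditioning on the arrival time and group of the best candidate; the two summands are the
contributions of the times in `(α, β)` and in `(β, 1)`. -/
theorem le_contProb_succ (hp : ∀ k, 0 ≤ p k) (hp1 : ∑ k, p k = 1) (hk : k₁ ≠ k₂)
    (h0 : 0 < thr k₁) (h12 : thr k₁ ≤ thr k₂) (h21 : thr k₂ ≤ 1) (B m : ℕ) :
    ENNReal.ofReal (p k₁ * thr k₁ * Real.log (thr k₂ / thr k₁) + thr k₁ * thr k₂ * S B (thr k₂)) ≤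
      contProb p (m + 1) fun l => Succ (contOk thr) B l ∨ Undecided (contOk thr) l := by
  set α := thr k₁ with hα
  set β := thr k₂ with hβ
  have hβ0 : 0 < β := h0.trans_le h12
  have hp1' : p k₂ + p k₁ = 1 := by rw [← sum_fin_two_of_ne hk]; exact hp1
  have hmid : ∀ s ∈ Set.Ioo α β, ENNReal.ofReal (α * (1 / s)) ≤ contProb p m fun l =>
      Succ (contOk thr) B ((s, k₁) :: l) ∨ Undecided (contOk thr) ((s, k₁) :: l) := by
    intro s hs
    have hs0 : 0 < s := h0.trans hs.1
    -- Taking `s` itself as the time from which records are admitted makes that range empty: no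
    -- comparison is used, and `logSum` equals `1`.
    have h1 := le_contProb_run hp hp1 hk h0 hs.1.le m (F := fun _ => s) (c := B) le_rfl
      (hs.2.le.trans h21) hs.2.le le_rfl
    simp only [logSum_self hs0, mul_one] at h1
    rw [mul_one_div]
    exact h1.trans (contProb_mono fun l hl => hl.imp (fun hl => ⟨hs.1.le, hl⟩)
      fun hl => Undecided.cons ⟨k₁, hl⟩ hs.1.le)
  have hhigh : ∀ i, ∀ s ∈ Set.Ioo β 1,
      ENNReal.ofReal (α * β * (1 / s ^ 2 * logSum β (B + 1) s)) ≤ contProb p m fun l =>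
        Succ (contOk thr) B ((s, i) :: l) ∨ Undecided (contOk thr) ((s, i) :: l) := by
    intro i s hs
    have hi : thr i ≤ s := by
      rcases eq_or_eq_of_ne hk i with rfl | rfl
      · exact h12.trans hs.1.le
      · exact hs.1.le
    exact (le_contProb_run_const hp hp1 hk h0 h12 hs.1.le hs.2.le B m).trans
      (contProb_mono fun l hl => hl.imp (fun hl => ⟨hi, hl⟩) fun hl => hl.cons hi)
  have hi1 : ∫ s in α..β, (p k₂ * 0 + p k₁ * (α * (1 / s))) = p k₁ * α * Real.log (β / α) := by
    simp only [mul_zero, zero_add]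
    rw [intervalIntegral.integral_const_mul, intervalIntegral.integral_const_mul,
      integral_one_div_of_pos h0 hβ0, mul_assoc]
  have hi2 : ∫ s in β..1, (p k₂ * (α * β * (1 / s ^ 2 * logSum β (B + 1) s)) +
      p k₁ * (α * β * (1 / s ^ 2 * logSum β (B + 1) s))) = α * β * S B β := by
    simp only [← add_mul, hp1', one_mul]
    rw [intervalIntegral.integral_const_mul, integral_logSum_div_sq hβ0 h21]
  have hc1 : ContinuousOn (fun s : ℝ => p k₂ * 0 + p k₁ * (α * (1 / s))) (Set.Icc α β) :=
    continuousOn_const.add (continuousOn_const.mul (continuousOn_const.mul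
      (continuousOn_const.div continuousOn_id fun u hu => (h0.trans_le hu.1).ne')))
  have hc2 : ContinuousOn (fun s : ℝ => α * β * (1 / s ^ 2 * logSum β (B + 1) s))
      (Set.Icc β 1) :=
    continuousOn_const.mul ((continuousOn_const.div (continuousOn_id.pow 2)
      fun u hu => (pow_pos (hβ0.trans_le hu.1) 2).ne').mul
        ((continuousOn_logSum hβ0 _).mono fun u hu => hβ0.trans_le hu.1))
  rw [contProb, ← hi1, ← hi2]
  refine (ofReal_add_le_lintegral_Ioo h12 h21 ?_ ?_).trans
    (lintegral_mono_set (Set.Ioo_subset_Ioo_left h0.le))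
  · refine ofReal_intervalIntegral_le h12 hc1 (fun s hs => ?_) fun s hs =>
      ofReal_le_sum_mul hp hk (by simp) (hmid s hs)
    have h2 : 0 < s := h0.trans hs.1
    exact add_nonneg (mul_nonneg (hp _) le_rfl) (mul_nonneg (hp _) (by positivity))
  · refine ofReal_intervalIntegral_le h21 ((hc2.const_mul _).add (hc2.const_mul _))
      (fun s hs => ?_) fun s hs => ofReal_le_sum_mul hp hk (hhigh _ s hs) (hhigh _ s hs)
    have h1 := logSum_nonneg hβ0 hs.1.le (B + 1)
    have h2 : 0 ≤ α * β * (1 / s ^ 2 * logSum β (B + 1) s) := by positivity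
    exact add_nonneg (mul_nonneg (hp _) h2) (mul_nonneg (hp _) h2)

end

/-! ### Prefixes of a uniform permutation and independent times -/

open Classical in
/-- Probability of an event about a uniform permutation and independent groups of law `p`. -/
noncomputable def permProb {K : ℕ} (p : Fin K → ℝ) (N : ℕ)
    (Q : Equiv.Perm (Fin N) → (Fin N → Fin K) → Prop) : ℝ :=
  ∑ σ : Equiv.Perm (Fin N), ∑ g : Fin N → Fin K,
    (1 / (N.factorial : ℝ)) * (∏ t : Fin N, p (g t)) * (if Q σ g then 1 else 0)

section

variable {K : ℕ} {p : Fin K → ℝ}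

theorem permProb_mono (hp : ∀ k, 0 ≤ p k) {N : ℕ}
    {Q Q' : Equiv.Perm (Fin N) → (Fin N → Fin K) → Prop} (h : ∀ σ g, Q σ g → Q' σ g) :
    permProb p N Q ≤ permProb p N Q' := by
  refine Finset.sum_le_sum fun σ _ => Finset.sum_le_sum fun g _ => ?_
  refine mul_le_mul_of_nonneg_left ?_
    (mul_nonneg (by positivity) (Finset.prod_nonneg fun t _ => hp _))
  by_cases h1 : Q σ g
  · simp [h1, h _ _ h1]
  · rw [if_neg h1]
    split_ifs <;> norm_num

theorem permProb_or_le (hp : ∀ k, 0 ≤ p k) {N : ℕ}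
    {Q Q' : Equiv.Perm (Fin N) → (Fin N → Fin K) → Prop} :
    permProb p N (fun σ g => Q σ g ∨ Q' σ g) ≤ permProb p N Q + permProb p N Q' := by
  unfold permProb
  simp only [← Finset.sum_add_distrib, ← mul_add]
  refine Finset.sum_le_sum fun σ _ => Finset.sum_le_sum fun g _ => ?_
  refine mul_le_mul_of_nonneg_left ?_
    (mul_nonneg (by positivity) (Finset.prod_nonneg fun t _ => hp _))
  by_cases h1 : Q σ g <;> by_cases h2 : Q' σ g <;> simp [h1, h2]

theorem dtSuccessProb_eq_permProb (thr : Fin K → ℝ) (B : ℕ) {N : ℕ} (hN : 0 < N) :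
    dtSuccessProb p (fun k _ => thr k) B N = permProb p N fun σ g =>
      Succ (discreteOk thr N) B (List.ofFn fun j : Fin N => ((σ j : ℕ), g (σ j))) := by
  unfold dtSuccessProb permProb
  rw [← Equiv.sum_comp ((Equiv.inv (Equiv.Perm (Fin N))).trans (Equiv.mulLeft Fin.revPerm))]
  refine Finset.sum_congr rfl fun σ _ => Finset.sum_congr rfl fun g _ => ?_
  congr 1
  have h1 := dtSucceeds_iff_succ (thr := thr) (B := B) (σ := σ) (g := g) hN
  by_cases h2 : DTSucceeds (fun k _ => thr k) B (σ.symm.trans Fin.revPerm) g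
  · exact (if_pos h2).trans (if_pos (h1.1 h2)).symm
  · exact (if_neg h2).trans (if_neg (mt h1.2 h2)).symm

/-- The groups at times outside the range of `t` are summed out, each giving a factor `1`. -/
theorem sum_prod_mul_comp {m N : ℕ} (hp1 : ∑ k, p k = 1) {t : Fin m → Fin N}
    (ht : Function.Injective t) (H : (Fin m → Fin K) → ℝ) :
    ∑ g : Fin N → Fin K, (∏ s, p (g s)) * H (fun j => g (t j)) =
      ∑ γ : Fin m → Fin K, (∏ j, p (γ j)) * H γ := by
  classical
  -- The constraint `g ∘ t = γ` is written inside the product, so that the sum over `g` factors over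
  -- the times.
  have h1 : ∀ g : Fin N → Fin K, (∏ s, p (g s)) * H (fun j => g (t j)) =
      ∑ γ : Fin m → Fin K, (∏ s, if ∀ j, t j = s → g s = γ j then p (g s) else 0) * H γ := by
    intro g
    rw [Finset.sum_eq_single (fun j => g (t j))]
    · congr 1
      refine Finset.prod_congr rfl fun s _ => (if_pos ?_).symm
      rintro j rfl
      rfl
    · intro γ _ hγ
      obtain ⟨j, hj⟩ := Function.ne_iff.1 hγ
      rw [Finset.prod_eq_zero (Finset.mem_univ (t j)), zero_mul]
      rw [if_neg]
      exact fun h => hj (h j rfl).symm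
    · simp
  simp only [h1]
  rw [Finset.sum_comm]
  refine Finset.sum_congr rfl fun γ _ => ?_
  rw [← Finset.sum_mul]
  congr 1
  have h2 := Finset.prod_univ_sum (fun _ : Fin N => (Finset.univ : Finset (Fin K)))
    (fun s k => if ∀ j, t j = s → k = γ j then p k else 0)
  rw [Fintype.piFinset_univ] at h2
  rw [← h2]
  refine (Fintype.prod_of_injective t ht _ _ (fun s hs => ?_) fun j => ?_).symm
  · rw [← hp1]
    refine Finset.sum_congr rfl fun k _ => if_pos ?_
    rintro j rfl
    exact absurd ⟨j, rfl⟩ hs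
  · rw [Finset.sum_eq_single (γ j)]
    · rw [if_pos]
      intro i hi
      rw [ht hi]
    · intro k _ hk
      exact if_neg fun h => hk (h j rfl)
    · simp

/-- Any two embeddings differ by a permutation, so the sum over `σ` is the same for every embedding
in place of `e`. Summing over all embeddings in both orders gives the identity. -/
theorem sum_perm_comp {m N : ℕ} (e : Fin m ↪ Fin N) (F : (Fin m ↪ Fin N) → ℝ) :
    (N.descFactorial m : ℝ) * ∑ σ : Equiv.Perm (Fin N), F (e.trans σ.toEmbedding) =
      N.factorial * ∑ t, F t := by
  have h1 : ∀ t : Fin m ↪ Fin N, ∑ σ : Equiv.Perm (Fin N), F (t.trans σ.toEmbedding) =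
      ∑ σ : Equiv.Perm (Fin N), F (e.trans σ.toEmbedding) := by
    intro t
    obtain ⟨τ, hτ⟩ := Equiv.Perm.exists_extending_pair e t e.injective t.injective
    rw [← Equiv.sum_comp (Equiv.mulRight τ) fun σ => F (e.trans σ.toEmbedding)]
    refine Finset.sum_congr rfl fun σ _ => congrArg F ?_
    ext j
    simp [hτ]
  have h2 : ∀ σ : Equiv.Perm (Fin N), ∑ t : Fin m ↪ Fin N, F (t.trans σ.toEmbedding) = ∑ t, F t :=
    fun σ => Equiv.sum_comp (Equiv.embeddingCongr (Equiv.refl _) σ) F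
  have h3 : ∑ t : Fin m ↪ Fin N, ∑ σ : Equiv.Perm (Fin N), F (t.trans σ.toEmbedding) =
      N.factorial * ∑ t, F t := by
    rw [Finset.sum_comm]
    simp [h2, Fintype.card_perm]
  rw [← h3]
  simp [h1, Fintype.card_embedding_eq]

theorem sum_fin_succ_arrow {X : Type*} [Fintype X] {m : ℕ} (f : (Fin (m + 1) → X) → ℝ) :
    ∑ w, f w = ∑ x, ∑ w' : Fin m → X, f (Fin.cons x w') := by
  rw [← Equiv.sum_comp (Fin.consEquiv fun _ => X) f, Fintype.sum_prod_type]
  rfl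

open Classical in
theorem discProb_eq_sum (N m : ℕ) (A : List (ℕ × Fin K) → Prop) :
    discProb p N m A = (1 / (N : ℝ)) ^ m * ∑ t : Fin m → Fin N, ∑ γ : Fin m → Fin K,
      (∏ j, p (γ j)) * (if A (List.ofFn fun j => ((t j : ℕ), γ j)) then 1 else 0) := by
  induction m generalizing A with
  | zero => simp [discProb]
  | succ m ih =>
    rw [discProb, pow_succ', mul_assoc, Finset.sum_range, sum_fin_succ_arrow]
    congr 1
    rw [Finset.mul_sum]
    refine Finset.sum_congr rfl fun t _ => ?_
    simp only [ih, sum_fin_succ_arrow, Fin.prod_univ_succ, List.ofFn_succ, Fin.cons_zero,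
      Fin.cons_succ]
    rw [Finset.sum_comm, Finset.mul_sum]
    refine Finset.sum_congr rfl fun k _ => ?_
    rw [mul_left_comm, Finset.mul_sum]
    congr 1
    refine Finset.sum_congr rfl fun w _ => ?_
    rw [Finset.mul_sum]
    exact Finset.sum_congr rfl fun γ _ => (mul_assoc _ _ _).symm

/-- The first `m` values of a uniform permutation are `m` independent uniform values conditioned to
be distinct. The factor is the inverse of the probability of distinctness. -/
theorem permProb_prefix (hp1 : ∑ k, p k = 1) {N m : ℕ} (hN : 0 < N) (hm : m ≤ N)
    (A : List (ℕ × Fin K) → Prop) :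
    permProb p N (fun σ g => A (List.ofFn fun j : Fin m =>
      ((σ (Fin.castLE hm j) : ℕ), g (σ (Fin.castLE hm j))))) =
    (N : ℝ) ^ m / N.descFactorial m * discProb p N m fun l => (l.map Prod.fst).Nodup ∧ A l := by
  classical
  set F : (Fin m ↪ Fin N) → ℝ := fun t => ∑ γ : Fin m → Fin K,
    (∏ j, p (γ j)) * (if A (List.ofFn fun j => ((t j : ℕ), γ j)) then 1 else 0) with hF
  have h1 : permProb p N (fun σ g => A (List.ofFn fun j : Fin m =>
      ((σ (Fin.castLE hm j) : ℕ), g (σ (Fin.castLE hm j))))) = 1 / (N.factorial : ℝ) *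
      ∑ σ : Equiv.Perm (Fin N), F ((Fin.castLEEmb hm).trans σ.toEmbedding) := by
    rw [permProb, Finset.mul_sum]
    refine Finset.sum_congr rfl fun σ _ => ?_
    rw [show F _ = _ from (sum_prod_mul_comp hp1
      ((Fin.castLEEmb hm).trans σ.toEmbedding).injective fun γ => if A (List.ofFn fun j =>
        ((((Fin.castLEEmb hm).trans σ.toEmbedding) j : ℕ), γ j)) then 1 else 0).symm, Finset.mul_sum]
    refine Finset.sum_congr rfl fun g _ => ?_
    rw [mul_assoc]
    rfl
  have h2 : discProb p N m (fun l => (l.map Prod.fst).Nodup ∧ A l) =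
      (1 / (N : ℝ)) ^ m * ∑ t, F t := by
    have h3 : ∀ (t : Fin m → Fin N) (γ : Fin m → Fin K),
        ((List.ofFn fun j => ((t j : ℕ), γ j)).map Prod.fst).Nodup ↔ Function.Injective t := by
      intro t γ
      rw [List.map_ofFn, List.nodup_ofFn]
      exact ⟨fun h i j hij => h (congrArg Fin.val hij), fun h => Fin.val_injective.comp h⟩
    rw [discProb_eq_sum]
    congr 1
    symm
    refine Fintype.sum_of_injective (fun t : Fin m ↪ Fin N => (t : Fin m → Fin N))
      DFunLike.coe_injective _ _ (fun t ht => ?_) fun t => ?_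
    · refine Finset.sum_eq_zero fun γ _ => ?_
      rw [if_neg, mul_zero]
      exact fun h => ht ⟨⟨t, (h3 t γ).1 h.1⟩, rfl⟩
    · refine Finset.sum_congr rfl fun γ _ => ?_
      simp only [(h3 t γ).2 t.injective, true_and]
  have h4 := sum_perm_comp (Fin.castLEEmb hm) F
  have h5 : (0 : ℝ) < N.descFactorial m := by exact_mod_cast Nat.descFactorial_pos.2 hm
  have h6 : (0 : ℝ) < N.factorial := by exact_mod_cast N.factorial_pos
  have hN' : (0 : ℝ) < N := by exact_mod_cast hN
  rw [h1, h2, one_div_mul_eq_div, div_eq_iff h6.ne', one_div, inv_pow]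
  field_simp
  linarith

theorem tendsto_pow_div_descFactorial (m : ℕ) :
    Tendsto (fun N : ℕ => (N : ℝ) ^ m / N.descFactorial m) atTop (𝓝 1) := by
  have h1 : ∀ N : ℕ, (N : ℝ) ^ m / N.descFactorial m =
      (∏ i ∈ Finset.range m, ((N - i : ℕ) : ℝ) / N)⁻¹ := by
    intro N
    rw [Finset.prod_div_distrib, Finset.prod_const, Finset.card_range, inv_div,
      Nat.descFactorial_eq_prod_range]
    push_cast
    rfl
  simp only [h1]
  have h2 : Tendsto (fun N : ℕ => ∏ i ∈ Finset.range m, ((N - i : ℕ) : ℝ) / N) atTop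
      (𝓝 (∏ i ∈ Finset.range m, 1)) := by
    refine tendsto_finsetProd _ fun i _ => ?_
    have h3 : Tendsto (fun N : ℕ => 1 - (i : ℝ) / N) atTop (𝓝 (1 - 0)) :=
      tendsto_const_nhds.sub (tendsto_const_div_atTop_nhds_zero_nat _)
    rw [sub_zero] at h3
    refine h3.congr' ?_
    filter_upwards [eventually_gt_atTop 0, eventually_ge_atTop i] with N hN hi
    rw [Nat.cast_sub hi, sub_div, div_self (by exact_mod_cast hN.ne')]
  simpa using h2.inv₀ (by simp)

end

/-! ### Existence of the limit and conclusion -/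

theorem contProb_all_le {p thr : Fin 2 → ℝ} (hp : ∀ k, 0 ≤ p k) (hp1 : ∑ k, p k = 1) {k : Fin 2}
    (h0 : 0 ≤ thr k) (h1 : thr k ≤ 1) (m : ℕ) :
    contProb p m (fun l => ∀ x ∈ l, x.2 = k → contOk thr x.1 k) ≤
      ENNReal.ofReal ((1 - p k * thr k) ^ m) := by
  obtain ⟨k', hk⟩ : ∃ k', k ≠ k' := ⟨k + 1, by fin_cases k <;> simp⟩
  have hp1' : p k' + p k = 1 := by rw [← sum_fin_two_of_ne hk]; exact hp1
  have hpk := hp k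
  have hpk' := hp k'
  have hr : 0 ≤ 1 - p k * thr k := by nlinarith
  induction m with
  | zero => simp [contProb]
  | succ m ih =>
    have hrm := pow_nonneg hr m
    have hC : ∀ i u, contProb p m (fun l => ∀ x ∈ (u, i) :: l, x.2 = k → contOk thr x.1 k) ≤
        ENNReal.ofReal ((1 - p k * thr k) ^ m) := fun i u => le_trans (contProb_mono fun l hl x hx =>
      hl x (List.mem_cons_of_mem _ hx)) ih
    have hzero : ∀ m, contProb p m (fun _ => False) = 0 := by
      intro m
      induction m with
      | zero => simp [contProb]
      | succ m ih => simp [contProb, ih]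
    have hlow : ∀ u ∈ Set.Ioo 0 (thr k), ∑ i, ENNReal.ofReal (p i) *
        contProb p m (fun l => ∀ x ∈ (u, i) :: l, x.2 = k → contOk thr x.1 k) ≤
        ENNReal.ofReal (p k' * (1 - p k * thr k) ^ m) := by
      intro u hu
      have h2 : contProb p m (fun l => ∀ x ∈ (u, k) :: l, x.2 = k → contOk thr x.1 k) = 0 := by
        rw [← hzero m]
        congr
        funext l
        exact eq_false fun h => absurd (h (u, k) List.mem_cons_self rfl) (not_le.2 hu.2)
      rw [sum_fin_two_of_ne hk, h2, mul_zero, add_zero, ENNReal.ofReal_mul hpk']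
      gcongr
      exact hC _ _
    have hhigh : ∀ u, ∑ i, ENNReal.ofReal (p i) *
        contProb p m (fun l => ∀ x ∈ (u, i) :: l, x.2 = k → contOk thr x.1 k) ≤
        ENNReal.ofReal ((1 - p k * thr k) ^ m) := by
      intro u
      calc _ ≤ ∑ i, ENNReal.ofReal (p i) * ENNReal.ofReal ((1 - p k * thr k) ^ m) := by
            gcongr
            exact hC _ _
        _ = _ := by
            rw [← Finset.sum_mul, ← ENNReal.ofReal_sum_of_nonneg fun i _ => hp i, hp1]
            simp
    have hsub : Set.Ioo (0 : ℝ) 1 ⊆ Set.Ioo 0 (thr k) ∪ Set.Ico (thr k) 1 := fun u hu => by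
      rcases lt_or_ge u (thr k) with h | h
      · exact Or.inl ⟨hu.1, h⟩
      · exact Or.inr ⟨h, hu.2⟩
    rw [contProb]
    refine (lintegral_mono_set hsub).trans ((lintegral_union_le _ _ _).trans
      ((add_le_add (setLIntegral_mono' measurableSet_Ioo hlow)
        (setLIntegral_mono' measurableSet_Ico fun u _ => hhigh u)).trans ?_))
    rw [setLIntegral_const, setLIntegral_const, Real.volume_Ioo, Real.volume_Ico,
      ← ENNReal.ofReal_mul (by positivity), ← ENNReal.ofReal_mul hrm,
      ← ENNReal.ofReal_add (by rw [sub_zero]; positivity) (mul_nonneg hrm (sub_nonneg.2 h1))]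
    refine ENNReal.ofReal_le_ofReal (le_of_eq ?_)
    have : p k' = 1 - p k := by linarith
    rw [this]
    ring

theorem tendsto_discProb_nodup {K : ℕ} {p thr : Fin K → ℝ} (hp : ∀ k, 0 ≤ p k)
    (hp1 : ∑ k, p k = 1) (m : ℕ) {A : ℕ → List (ℕ × Fin K) → Prop} {A' : List (ℝ × Fin K) → Prop}
    (h : ∀ (N : ℕ) (l : List (ℝ × Fin K)),
      StrictMonoOn (fun u : ℝ => ⌊(N : ℝ) * u⌋₊) {u | ∃ x ∈ l, x.1 = u} →
      (∀ t ∈ {u | ∃ x ∈ l, x.1 = u}, ∀ k, discreteOk thr N ⌊(N : ℝ) * t⌋₊ k ↔ contOk thr t k) →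
      (A N (l.map fun x => (⌊(N : ℝ) * x.1⌋₊, x.2)) ↔ A' l)) :
    Tendsto (fun N : ℕ => (N : ℝ) ^ m / N.descFactorial m *
      discProb p N m fun l => (l.map Prod.fst).Nodup ∧ A N l) atTop
      (𝓝 (contProb p m A').toReal) := by
  have h1 : Tendsto (fun N : ℕ => ENNReal.ofReal
      (discProb p N m fun l => (l.map Prod.fst).Nodup ∧ A N l)) atTop (𝓝 (contProb p m A')) := by
    refine tendsto_discProb hp hp1 m (Set.finite_range thr).countable fun l _ hl hnd => ?_
    filter_upwards [eventually_pattern thr hl] with N hN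
    rw [h N l hN.1 hN.2, and_iff_right_iff_imp]
    intro _
    have h2 := List.Nodup.map_on (f := fun u : ℝ => ⌊(N : ℝ) * u⌋₊) (fun u hu v hv huv => ?_) hnd
    · simpa [List.map_map, Function.comp_def] using h2
    · obtain ⟨x, hx, rfl⟩ := List.mem_map.1 hu
      obtain ⟨y, hy, rfl⟩ := List.mem_map.1 hv
      exact hN.1.injOn ⟨x, hx, rfl⟩ ⟨y, hy, rfl⟩ huv
  have h2 := (ENNReal.tendsto_toReal
    (ne_top_of_le_ne_top ENNReal.one_ne_top (contProb_le_one hp hp1 m A'))).comp h1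
  have h3 := (tendsto_pow_div_descFactorial m).mul h2
  rw [one_mul] at h3
  refine h3.congr fun N => ?_
  simp only [Function.comp_apply]
  rw [ENNReal.toReal_ofReal (discProb_nonneg hp _ _ _)]

/-- For each `m`, `P` lies eventually between `Q m - δ m` and `Q m`, hence asymptotically in an
interval of length `d m`. As `d m → 0`, `P` is Cauchy, and `U ≤ L + d m` passes to the limit. -/
theorem exists_tendsto_of_sandwich {P : ℕ → ℝ} {Q δ : ℕ → ℕ → ℝ} {e d : ℕ → ℝ} {U : ℝ}
    (hQ : ∀ m, Tendsto (Q m) atTop (𝓝 (e m))) (hδ : ∀ m, Tendsto (δ m) atTop (𝓝 (d m)))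
    (hd : Tendsto d atTop (𝓝 0)) (h1 : ∀ m, ∀ᶠ N in atTop, P N ≤ Q m N)
    (h2 : ∀ m, ∀ᶠ N in atTop, Q m N ≤ P N + δ m N) (hU : ∀ m, U ≤ e m) :
    ∃ L, Tendsto P atTop (𝓝 L) ∧ U ≤ L := by
  have hc : CauchySeq P := by
    rw [Metric.cauchySeq_iff']
    intro ε hε
    obtain ⟨m, hm⟩ := (hd.eventually_lt_const (show (0 : ℝ) < ε / 8 by positivity)).exists
    have h3 : ∀ᶠ N in atTop, P N < e m + ε / 8 ∧ e m - 3 * ε / 8 < P N := by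
      filter_upwards [h1 m, h2 m,
        (hQ m).eventually_lt_const (show e m < e m + ε / 8 by linarith),
        (hQ m).eventually_const_lt (show e m - ε / 8 < e m by linarith),
        (hδ m).eventually_lt_const (show d m < ε / 4 by linarith)] with N a b c d' f
      exact ⟨by linarith, by linarith⟩
    obtain ⟨N, hN⟩ := eventually_atTop.1 h3
    refine ⟨N, fun n hn => ?_⟩
    have ha := hN n hn
    have hb := hN N le_rfl
    rw [Real.dist_eq, abs_lt]
    constructor <;> linarith [ha.1, ha.2, hb.1, hb.2]
  obtain ⟨L, hL⟩ := cauchySeq_tendsto_of_complete hc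
  refine ⟨L, hL, ?_⟩
  have h3 : ∀ m, U ≤ L + d m := fun m => (hU m).trans
    (le_of_tendsto_of_tendsto (hQ m) (hL.add (hδ m)) (h2 m))
  have h4 : Tendsto (fun m => L + d m) atTop (𝓝 (L + 0)) := hd.const_add L
  rw [add_zero] at h4
  exact ge_of_tendsto' h4 h3

theorem permProb_exists_le {p : Fin 2 → ℝ} (hp : ∀ k, 0 ≤ p k) {N : ℕ}
    {Q : Fin 2 → Equiv.Perm (Fin N) → (Fin N → Fin 2) → Prop} :
    permProb p N (fun σ g => ∃ k, Q k σ g) ≤ permProb p N (Q 0) + permProb p N (Q 1) := by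
  simp only [Fin.exists_fin_two]
  exact permProb_or_le hp

/-- The limit of the success probability of the double-threshold algorithm exists, and is at least the
probability to succeed without comparison before the larger threshold. -/
theorem exists_tendsto_dtSuccessProb {p thr : Fin 2 → ℝ} (hp : ∀ k, 0 < p k)
    (hp1 : ∑ k, p k = 1) {k₁ k₂ : Fin 2} (hk : k₁ ≠ k₂) (h0 : 0 < thr k₁) (h12 : thr k₁ ≤ thr k₂)
    (h21 : thr k₂ ≤ 1) (B : ℕ) :
    ∃ L, Tendsto (fun N => dtSuccessProb p (fun k _ => thr k) B N) atTop (𝓝 L) ∧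
      p k₁ * thr k₁ * Real.log (thr k₂ / thr k₁) + thr k₁ * thr k₂ * S B (thr k₂) ≤ L := by
  have hp' := fun k => (hp k).le
  have hthr : ∀ k, 0 < thr k ∧ thr k ≤ 1 := fun k => by
    rcases eq_or_eq_of_ne hk k with rfl | rfl
    exacts [⟨h0, h12.trans h21⟩, ⟨h0.trans_le h12, h21⟩]
  have hS : 0 ≤ S B (thr k₂) := S_nonneg (hthr k₂).1 h21 B
  -- Undecided prefixes are counted as successes, so `e m` bounds the success probability from above
  -- asymptotically. The excess is at most the sum of the two `d'`, which decay geometrically.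
  set e : ℕ → ℝ := fun m => (contProb p (m + 1) fun l =>
    Succ (contOk thr) B l ∨ Undecided (contOk thr) l).toReal with he
  set d' : Fin 2 → ℕ → ℝ := fun k m => (contProb p (m + 1) fun l =>
    ∀ x ∈ l, x.2 = k → contOk thr x.1 k).toReal with hd'
  have hmap : ∀ (N : ℕ) (l : List (ℝ × Fin 2)) (k : Fin 2),
      (∀ t ∈ {u | ∃ x ∈ l, x.1 = u}, ∀ k, discreteOk thr N ⌊(N : ℝ) * t⌋₊ k ↔ contOk thr t k) →
      ((∀ x ∈ l.map (fun x => (⌊(N : ℝ) * x.1⌋₊, x.2)), x.2 = k → discreteOk thr N x.1 k) ↔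
        ∀ x ∈ l, x.2 = k → contOk thr x.1 k) := by
    intro N l k h
    rw [List.forall_mem_map]
    exact forall₂_congr fun x hx => imp_congr_right fun _ => h _ ⟨x, hx, rfl⟩ k
  have hQ := fun m : ℕ => tendsto_discProb_nodup hp' hp1 (m + 1) (thr := thr)
    (A := fun N l => Succ (discreteOk thr N) B l ∨ Undecided (discreteOk thr N) l)
    (A' := fun l => Succ (contOk thr) B l ∨ Undecided (contOk thr) l) fun N l hl1 hl2 => by
      refine or_congr (succ_map hl1 hl2 fun x hx => ⟨x, hx, rfl⟩) (exists_congr fun k => ?_)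
      exact hmap N l k hl2
  have hδ := fun (k : Fin 2) (m : ℕ) => tendsto_discProb_nodup hp' hp1 (m + 1) (thr := thr)
    (A := fun N l => ∀ x ∈ l, x.2 = k → discreteOk thr N x.1 k)
    (A' := fun l => ∀ x ∈ l, x.2 = k → contOk thr x.1 k) fun N l _ hl2 => hmap N l k hl2
  have hd0 : ∀ k, Tendsto (d' k) atTop (𝓝 0) := by
    intro k
    have hk1 : p k ≤ 1 := by
      rw [← hp1]
      exact Finset.single_le_sum (fun i _ => hp' i) (Finset.mem_univ k)
    have h3 : 0 < p k * thr k := mul_pos (hp k) (hthr k).1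
    have h4 : 0 ≤ 1 - p k * thr k := sub_nonneg.2 (mul_le_one₀ hk1 (hthr k).1.le (hthr k).2)
    have h5 := (tendsto_add_atTop_iff_nat 1).2
      (tendsto_pow_atTop_nhds_zero_of_lt_one h4 (by linarith))
    refine squeeze_zero (fun m => ENNReal.toReal_nonneg) (fun m => ?_) h5
    exact ENNReal.toReal_le_of_le_ofReal (pow_nonneg h4 _)
      (contProb_all_le hp' hp1 (hthr k).1.le (hthr k).2 (m + 1))
  have hlist : ∀ {m N : ℕ} (hm : m + 1 ≤ N) (σ : Equiv.Perm (Fin N)) (g : Fin N → Fin 2),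
      ¬ Undecided (discreteOk thr N) (List.ofFn fun j : Fin (m + 1) =>
        ((σ (Fin.castLE hm j) : ℕ), g (σ (Fin.castLE hm j)))) →
      (Succ (discreteOk thr N) B (List.ofFn fun j : Fin N => ((σ j : ℕ), g (σ j))) ↔
        Succ (discreteOk thr N) B (List.ofFn fun j : Fin (m + 1) =>
          ((σ (Fin.castLE hm j) : ℕ), g (σ (Fin.castLE hm j))))) := by
    intro m N hm σ g hU
    have h3 : (List.ofFn fun j : Fin (m + 1) =>
        ((σ (Fin.castLE hm j) : ℕ), g (σ (Fin.castLE hm j)))) =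
        (List.ofFn fun j : Fin N => ((σ j : ℕ), g (σ j))).take (m + 1) :=
      Fin.ofFn_take_eq_take_ofFn hm fun j : Fin N => ((σ j : ℕ), g (σ j))
    conv_lhs => rw [← List.take_append_drop (m + 1) (List.ofFn _), ← h3]
    refine succ_append (by simp) fun k => ?_
    by_contra hcon
    refine hU ⟨k, fun x hx hxk => ?_⟩
    by_contra hx1
    -- Allowed times are upward closed, so a forbidden time `x.1` forbids all earlier ones.
    refine hcon ⟨x, hx, hxk, fun t ht h4 => hx1 ?_⟩
    exact le_trans (show _ ≤ t + 1 from h4) (Nat.succ_le_succ ht)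
  have hd01 := (hd0 0).add (hd0 1)
  rw [add_zero] at hd01
  refine exists_tendsto_of_sandwich hQ (fun m => (hδ 0 m).add (hδ 1 m))
    hd01 (fun m => ?_) (fun m => ?_) fun m => ?_
  · filter_upwards [eventually_ge_atTop (m + 1)] with N hN
    have hN0 : 0 < N := by omega
    rw [dtSuccessProb_eq_permProb thr B hN0, ← permProb_prefix hp1 hN0 hN]
    refine permProb_mono hp' fun σ g h => ?_
    by_cases hU : Undecided (discreteOk thr N) (List.ofFn fun j : Fin (m + 1) =>
        ((σ (Fin.castLE hN j) : ℕ), g (σ (Fin.castLE hN j))))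
    · exact Or.inr hU
    · exact Or.inl ((hlist hN σ g hU).1 h)
  · filter_upwards [eventually_ge_atTop (m + 1)] with N hN
    have hN0 : 0 < N := by omega
    rw [dtSuccessProb_eq_permProb thr B hN0, ← permProb_prefix hp1 hN0 hN,
      ← permProb_prefix hp1 hN0 hN, ← permProb_prefix hp1 hN0 hN]
    refine (permProb_mono hp' fun σ g h => ?_).trans ((permProb_or_le hp').trans
      (add_le_add_right (permProb_exists_le hp' (Q := fun k σ g => ∀ x ∈ (List.ofFn
        fun j : Fin (m + 1) => ((σ (Fin.castLE hN j) : ℕ), g (σ (Fin.castLE hN j)))),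
          x.2 = k → discreteOk thr N x.1 k)) _))
    by_cases hU : Undecided (discreteOk thr N) (List.ofFn fun j : Fin (m + 1) =>
        ((σ (Fin.castLE hN j) : ℕ), g (σ (Fin.castLE hN j))))
    · exact Or.inr hU
    · exact Or.inl ((hlist hN σ g hU).2 (h.resolve_right hU))
  · rw [← ENNReal.ofReal_le_iff_le_toReal
      (ne_top_of_le_ne_top ENNReal.one_ne_top (contProb_le_one hp' hp1 _ _))]
    exact le_contProb_succ hp' hp1 hk h0 h12 h21 B m

theorem exists_tendsto_ge_guarantee {p thr : Fin 2 → ℝ} (hp : ∀ k, 0 < p k)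
    (hp1 : ∑ k, p k = 1) {k₁ k₂ : Fin 2} (hk : k₁ ≠ k₂) {B : ℕ} (hhalf : 1 / 2 ≤ p k₁)
    (hopt : IsOptimalThreshold (p k₁) B (thr k₂)) (hthr : thr k₁ = h (p k₁) B (thr k₂)) :
    ∃ L, Tendsto (fun N => dtSuccessProb p (fun k _ => thr k) B N) atTop (𝓝 L) ∧
      guarantee (p k₁) B ≤ L := by
  have hpos := hopt.pos (hp k₁)
  have hle : p k₁ ≤ 1 := by
    rw [← hp1]
    exact Finset.single_le_sum (fun i _ => (hp i).le) (Finset.mem_univ k₁)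
  obtain ⟨L, hL, hUL⟩ := exists_tendsto_dtSuccessProb hp hp1 hk
    (by rw [hthr]; exact h_pos B hpos) (by rw [hthr]; exact h_le _ _ _) hopt.1.2 B
  refine ⟨L, hL, (guarantee_le_of_isOptimalThreshold hhalf hle hopt).trans ?_⟩
  rwa [hthr] at hUL

end MultiColorSecretary

theorem mainTheorem4 (B : ℕ) (lam : ℝ) (hlam0 : 0 < lam) (hlam1 : lam < 1) :
    (1 / 2 ≤ lam →
      (∃ β : ℝ, MultiColorSecretary.IsOptimalThreshold lam B β) ∧
      ∀ β : ℝ, MultiColorSecretary.IsOptimalThreshold lam B β →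
        ∃ L : ℝ,
          Tendsto (fun N : ℕ => MultiColorSecretary.doubleThresholdSuccessProb lam B
            (MultiColorSecretary.h lam B β) β N) atTop (𝓝 L) ∧
          MultiColorSecretary.guarantee lam B ≤ L) ∧
    (lam < 1 / 2 →
      (∃ β : ℝ, MultiColorSecretary.IsOptimalThreshold (1 - lam) B β) ∧
      ∀ β : ℝ, MultiColorSecretary.IsOptimalThreshold (1 - lam) B β →
        ∃ L : ℝ,
          Tendsto (fun N : ℕ => MultiColorSecretary.doubleThresholdSuccessProb lam B
            β (MultiColorSecretary.h (1 - lam) B β) N) atTop (𝓝 L) ∧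
          MultiColorSecretary.guarantee lam B ≤ L) := by
  have hp : ∀ k, 0 < (![lam, 1 - lam] : Fin 2 → ℝ) k := by
    intro k
    fin_cases k
    · exact hlam0
    · exact sub_pos.2 hlam1
  have hp1 : ∑ k, (![lam, 1 - lam] : Fin 2 → ℝ) k = 1 := by simp
  constructor
  · intro hhalf
    refine ⟨MultiColorSecretary.exists_isOptimalThreshold B hlam0, fun β hβ => ?_⟩
    exact MultiColorSecretary.exists_tendsto_ge_guarantee (thr := ![_, β]) hp hp1
      (k₁ := 0) (k₂ := 1) (by decide) hhalf hβ rfl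
  · intro hhalf
    refine ⟨MultiColorSecretary.exists_isOptimalThreshold B (by linarith), fun β hβ => ?_⟩
    rw [← MultiColorSecretary.guarantee_one_sub]
    exact MultiColorSecretary.exists_tendsto_ge_guarantee (thr := ![β, _]) hp hp1
      (k₁ := 1) (k₂ := 0) (by decide) (show 1 / 2 ≤ 1 - lam by linarith) hβ rfl
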